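/- Graphs are undirected and simple. A graph $H$ embeds in a graph $G$ if $H$ is isomorphic to an induced subgraph of $G$. The age of a graph $G$ (finite or infinite) is the class of finite graphs, considered up to isomorphism, that embed in $G$; an age is a class of finite graphs that is the age of some graph, and a subage of an age $\mathcal C$ is an age contained in $\mathcal C$. A class of finite graphs is well-quasi-ordered (w.q.o.) if it contains no infinite set of graphs that are pairwise incomparable with respect to embeddability. A graph $G=(V,E)$ is a permutation graph if there are a linear order on $V$ and a permutation $\sigma$ of $V$ such that the edges of $G$ are exactly the pairs $\{x,y\}$ of distinct vertices reversed by $\sigma$. For an integer $n\ge 1$, the double-ended fork $\mathrm{DF}_n$ is the graph obtained from a path of length $n$ (with $n+1$ vertices) by attaching two pendant vertices to each of its two end vertices. The direct sum $\bigoplus_{i\in I} G_i$ of a family of graphs is their disjoint union. Theorem. Let $\mathcal C$ be an age that consists of finite bipartite permutation graphs. Then $\mathcal C$ is not w.q.o. if and only if there is an infinite set $I$ of positive integers such that $\mathcal C$ contains the age of the direct sum $\bigoplus_{i\in I}\mathrm{DF}_i$. Moreover, if $\mathcal C$ is not w.q.o., then the set of subages of $\mathcal C$ that are not w.q.o. has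 cardinality exactly $2^{\aleph_0}$. -/

import Mathlib

universe u

/-- Finite graphs up to isomorphy: every finite graph is isomorphic to a graph on some `Fin n`.
A class of finite graphs closed under isomorphism is represented by the set of its members on the
vertex sets `Fin n`. -/
abbrev FinGraph : Type := Σ n : ℕ, SimpleGraph (Fin n)

namespace FinGraph

/-- Embeddability: `G` is isomorphic to an induced subgraph of `H`. -/
def Embeds (G H : FinGraph) : Prop := G.2.IsIndContained H.2

/-- `C` is well-quasi-ordered: it contains no infinite antichain, i.e. no infinite set of graphs
pairwise incomparable with respect to embeddability. -/
def IsWQO (C : Set FinGraph) : Prop :=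
  ∀ A : Set FinGraph, A ⊆ C → IsAntichain Embeds A → A.Finite

end FinGraph

namespace SimpleGraph

/-- The age of a (finite or infinite) graph `G`: the finite graphs that embed in `G`. -/
def graphAge {V : Type u} (G : SimpleGraph V) : Set FinGraph :=
  {H | H.2.IsIndContained G}

/-- `G` is a permutation graph: for some linear order on `V` and some permutation `σ` of `V`,
the edges of `G` are exactly the pairs reversed by `σ`. -/
def IsPermutationGraph {V : Type u} (G : SimpleGraph V) : Prop :=
  ∃ (L : LinearOrder V) (σ : Equiv.Perm V), ∀ x y : V,
    G.Adj x y ↔ (L.lt x y ∧ L.lt (σ y) (σ x)) ∨ (L.lt y x ∧ L.lt (σ x) (σ y))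

/-- The direct sum (disjoint union) of a family of graphs. -/
def directSum {ι : Type} {V : ι → Type} (G : ∀ i, SimpleGraph (V i)) :
    SimpleGraph (Σ i, V i) where
  Adj x y := ∃ (i : ι) (a b : V i), (G i).Adj a b ∧ x = ⟨i, a⟩ ∧ y = ⟨i, b⟩
  symm := ⟨by
    rintro x y ⟨i, a, b, h, hx, hy⟩
    exact ⟨i, b, a, h.symm, hy, hx⟩⟩
  loopless := ⟨by
    rintro x ⟨i, a, b, h, hx, hy⟩
    have hab : a = b := by
      have := hx.symm.trans hy
      simpa using this
    exact h.ne hab⟩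

/-- The edges of a double-ended fork, each listed in one direction: the edges of the path
`0, 1, …, n`, two leaves `(false, _)` attached to `0` and two leaves `(true, _)` attached
to `n`. -/
def doubleEndedForkRel (n : ℕ) :
    Fin (n + 1) ⊕ (Bool × Bool) → Fin (n + 1) ⊕ (Bool × Bool) → Prop
  | .inl i, .inl j => i.val + 1 = j.val
  | .inl i, .inr (false, _) => i = 0
  | .inl i, .inr (true, _) => i = Fin.last n
  | .inr _, _ => False

/-- The double-ended fork of length `n`: a path of length `n` (with `n + 1` vertices) with two
pendant vertices attached at each of its two ends. It is used for `1 ≤ n` only. -/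
def doubleEndedFork (n : ℕ) : SimpleGraph (Fin (n + 1) ⊕ (Bool × Bool)) :=
  SimpleGraph.fromRel (doubleEndedForkRel n)

end SimpleGraph

/-- `C` is an age: the age of some graph. -/
def IsAge (C : Set FinGraph) : Prop :=
  ∃ (V : Type u) (G : SimpleGraph V), C = G.graphAge

/-!
The proof rests on one picture of connected bipartite permutation graphs. A permutation graph is
the incomparability graph of a strict order on its vertices (`IsIncomparabilityGraph`), and in a
connected graph the distance from a minimal vertex is monotone for this order. If the graph is
bipartite, vertices at the same distance are comparable, and the neighbourhoods between two
consecutive distance levels form two chains. Suitable heights turn this into a level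
representation (`LevelRep`, `IsIncomparabilityGraph.exists_levelRep`): the edges join exactly the
vertices on consecutive levels of which the lower level carries the higher vertex. The highest
vertices of the levels form a path, each being joined to its whole next level, so that two distant
levels with at least two vertices each yield a long double-ended fork
(`LevelRep.exists_fork`).

If the forks in a hereditary class have bounded length, then every connected member is therefore a
window of boundedly many levels, preceded and followed by levels that are single vertices. The
vertices listed by height and labelled by level form a word over a finite alphabet, and Higman's
lemma gives well-quasi-order (`FinGraph.partiallyWellOrderedOn_hasWindow`); a second application,
to lists of connected components, removes connectedness (`FinGraph.isWQO_of_forkFree`).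

So the age of `G` is well-quasi-ordered unless arbitrarily long forks embed in `G`. In that case
forks can be chosen one after the other, disjoint and mutually non-adjacent
(`IsLocallyBipartitePermutation.exists_fork_avoiding`): either some component not yet used contains
a long fork, or one component contains arbitrarily long forks. The distance between the ends of an
induced path grows linearly with its length, so this component has vertices of degree at least
three arbitrarily far from a given vertex `s`; two of three such vertices lie on the same side of
`s`. In a union of geodesics from `s` to these two, `s` is extremal for the order, and the level
representation rooted at `s` produces a long fork far from `s`.

Conversely, double-ended forks of different lengths are incomparable, so the age of a sum of
infinitely many of them is not well-quasi-ordered, and it determines the set of lengths. The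
continuum many infinite subsets of `I` give continuum many subages.
-/

namespace SimpleGraph

/-! ### Incomparability graphs and distance levels -/

/-- `G` is the incomparability graph of the strict partial order `lt`. -/
structure IsIncomparabilityGraph {V : Type*} (G : SimpleGraph V) (lt : V → V → Prop) : Prop where
  irrefl : ∀ v, ¬ lt v v
  trans : ∀ u v w, lt u v → lt v w → lt u w
  adj_iff : ∀ u v, G.Adj u v ↔ u ≠ v ∧ ¬ lt u v ∧ ¬ lt v u

namespace IsIncomparabilityGraph

variable {V : Type*} {G : SimpleGraph V} {lt : V → V → Prop}

theorem asymm (h : IsIncomparabilityGraph G lt) {u v : V} (huv : lt u v) : ¬ lt v u :=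
  fun hvu => h.irrefl _ (h.trans _ _ _ huv hvu)

theorem swap (h : IsIncomparabilityGraph G lt) :
    IsIncomparabilityGraph G (fun u v => lt v u) where
  irrefl := h.irrefl
  trans u v w huv hvw := h.trans _ _ _ hvw huv
  adj_iff u v := by rw [h.adj_iff]; tauto

theorem comparable (h : IsIncomparabilityGraph G lt) {u v : V} (hne : u ≠ v)
    (hadj : ¬ G.Adj u v) : lt u v ∨ lt v u := by
  rw [h.adj_iff] at hadj
  tauto

theorem not_adj_of_lt (h : IsIncomparabilityGraph G lt) {u v : V} (huv : lt u v) :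
    ¬ G.Adj u v := by
  rw [h.adj_iff]
  tauto

theorem not_adj_of_gt (h : IsIncomparabilityGraph G lt) {u v : V} (huv : lt v u) :
    ¬ G.Adj u v := by
  rw [h.adj_iff]
  tauto

/-- A walk that starts outside the up-set of `v` and ends inside it passes, before its end, through
`v` or through a neighbour of `v`. -/
theorem dist_le_of_walk (h : IsIncomparabilityGraph G lt) (hG : G.Connected) {v b u : V}
    (p : G.Walk b u) (hb : ¬ lt v b) (hu : lt v u) : G.dist b v ≤ p.length := by
  induction p with
  | nil => exact absurd hu hb
  | @cons b c u hbc p ih =>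
    rw [Walk.length_cons]
    by_cases hc : lt v c
    · by_cases hvb : b = v
      · subst hvb; simp
      · have hbv : G.Adj b v := by
          by_contra hn
          rcases h.comparable hvb hn with h1 | h1
          · exact h.not_adj_of_lt (h.trans _ _ _ h1 hc) hbc
          · exact hb h1
        have := dist_le hbv.toWalk
        simp at this
        omega
    · have h1 := ih hc hu
      have h2 := dist_le hbc.toWalk
      have h3 := hG.dist_triangle (u := b) (v := c) (w := v)
      simp at h2
      omega

/-- The distance from a minimal element is monotone for the order. -/
theorem dist_mono (h : IsIncomparabilityGraph G lt) (hG : G.Connected) {a : V}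
    (ha : ∀ v, ¬ lt v a) {u v : V} (huv : lt v u) : G.dist a v ≤ G.dist a u := by
  obtain ⟨p, hp⟩ := hG.exists_walk_length_eq_dist a u
  exact hp ▸ h.dist_le_of_walk hG p (ha v) huv

/-- On a distance level, the neighbourhoods in the preceding level decrease along the order. -/
theorem adj_of_lt_left (h : IsIncomparabilityGraph G lt) (hG : G.Connected) {a : V}
    (ha : ∀ v, ¬ lt v a) {u v v' : V} (hvv : lt v v') (huv : G.Adj u v')
    (hd : G.dist a v = G.dist a u + 1) : G.Adj u v := by
  by_contra hn
  have hne : u ≠ v := by rintro rfl; omega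
  rcases h.comparable hne hn with h1 | h1
  · exact h.not_adj_of_lt (h.trans _ _ _ h1 hvv) huv
  · have := h.dist_mono hG ha h1
    omega

/-- On a distance level, the neighbourhoods in the next level increase along the order. -/
theorem adj_of_lt_right (h : IsIncomparabilityGraph G lt) (hG : G.Connected) {a : V}
    (ha : ∀ v, ¬ lt v a) {u u' v : V} (huu : lt u u') (huv : G.Adj u v)
    (hd : G.dist a v = G.dist a u' + 1) : G.Adj u' v := by
  by_contra hn
  have hne : u' ≠ v := by rintro rfl; omega
  rcases h.comparable hne hn with h1 | h1
  · exact h.not_adj_of_lt (h.trans _ _ _ huu h1) huv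
  · have := h.dist_mono hG ha h1
    omega

end IsIncomparabilityGraph

theorem dist_ne_of_adj {V : Type*} {G : SimpleGraph V} (hG : G.Connected) (hb : G.IsBipartite)
    (a : V) {u v : V} (huv : G.Adj u v) : G.dist a u ≠ G.dist a v := by
  intro he
  obtain ⟨c⟩ := (hb : G.Colorable 2)
  let c' : G.Coloring Bool := G.recolorOfEquiv finTwoEquiv c
  obtain ⟨p, hp⟩ := hG.exists_walk_length_eq_dist a u
  obtain ⟨q, hq⟩ := hG.exists_walk_length_eq_dist a v
  have h1 := c'.even_length_iff_congr p
  have h2 := c'.even_length_iff_congr q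
  rw [hp, he] at h1
  rw [hq] at h2
  have h3 := c'.valid huv
  revert h1 h2 h3
  generalize c' a = x
  generalize c' u = y
  generalize c' v = z
  cases x <;> cases y <;> cases z <;> simp

theorem dist_succ_or_of_adj {V : Type*} {G : SimpleGraph V} (hG : G.Connected)
    (hb : G.IsBipartite) (a : V) {u v : V} (huv : G.Adj u v) :
    G.dist a v = G.dist a u + 1 ∨ G.dist a u = G.dist a v + 1 := by
  have h0 := dist_ne_of_adj hG hb a huv
  have h1 := dist_le huv.toWalk
  have h2 := dist_le huv.symm.toWalk
  have h3 := hG.dist_triangle (u := a) (v := u) (w := v)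
  have h4 := hG.dist_triangle (u := a) (v := v) (w := u)
  simp at h1 h2
  omega

theorem exists_adj_dist_eq {V : Type*} {G : SimpleGraph V} (hG : G.Connected) (a : V) {v : V}
    {k : ℕ} (hv : G.dist a v = k + 1) : ∃ u, G.dist a u = k ∧ G.Adj u v := by
  obtain ⟨p, hp⟩ := hG.exists_walk_length_eq_dist v a
  rw [dist_comm, hv] at hp
  cases p with
  | nil => simp at hp
  | @cons _ u _ h p =>
    rw [Walk.length_cons] at hp
    refine ⟨u, ?_, h.symm⟩
    have h1 := dist_le p
    have h2 := hG.dist_triangle (u := a) (v := u) (w := v)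
    have h3 := dist_le h.symm.toWalk
    simp at h3
    rw [dist_comm] at h1
    omega

/-! ### Level representations -/

/-- A level representation of `G` with root `r`: every vertex `v` has a level `l v` and a height
`h v`, and the edges join exactly the pairs of vertices on consecutive levels for which the vertex
on the smaller level is the higher one. The root is the only vertex on level `0`, and every other
vertex has a neighbour on the preceding level. -/
structure LevelRep {V : Type*} (G : SimpleGraph V) (r : V) (l h : V → ℕ) : Prop where
  adj_iff : ∀ u v, G.Adj u v ↔ (l v = l u + 1 ∧ h v < h u) ∨ (l u = l v + 1 ∧ h u < h v)
  height_ne : ∀ u v, u ≠ v → (l u = l v ∨ l v = l u + 1) → h u ≠ h v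
  level_zero : ∀ v, l v = 0 ↔ v = r
  parent : ∀ v k, l v = k + 1 → ∃ u, l u = k ∧ G.Adj u v

open Classical in
/-- Heights realising given levels `d`: a vertex on level `k + 1` is put just above its highest
non-neighbour on level `k`, the vertices with the same highest non-neighbour being spread out
according to their rank `rk`. The spacing `ε k` of level `k` leaves enough room for level
`k + 1`. -/
noncomputable def levelHeight {V : Type*} [Fintype V] (G : SimpleGraph V) (d rk : V → ℕ)
    (ε : ℕ → ℕ) : ℕ → V → ℕ
  | 0, v => (rk v + 1) * ε 0
  | k + 1, v => (Finset.univ.filter fun u => d u = k ∧ ¬ G.Adj u v).sup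
      (levelHeight G d rk ε k) + (rk v + 1) * ε (k + 1)

/-- The distances from a minimal vertex are the levels of a level representation. -/
theorem IsIncomparabilityGraph.exists_levelRep {V : Type*} [Finite V] {G : SimpleGraph V}
    {lt : V → V → Prop} (h : IsIncomparabilityGraph G lt) (hG : G.Connected)
    (hb : G.IsBipartite) {a : V} (ha : ∀ v, ¬ lt v a) :
    ∃ f : V → ℕ, LevelRep G a (G.dist a) f := by
  classical
  have := Fintype.ofFinite V
  set d : V → ℕ := G.dist a with hd
  let rk : V → ℕ := fun v => (Finset.univ.filter fun u => lt u v).card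
  have hrk : ∀ u v, lt u v → rk u < rk v := by
    intro u v huv
    apply Finset.card_lt_card
    rw [Finset.ssubset_iff_of_subset]
    · exact ⟨u, by simpa using huv, by simpa using h.irrefl u⟩
    · intro w hw
      simp only [Finset.mem_filter, Finset.mem_univ, true_and] at hw ⊢
      exact h.trans _ _ _ hw huv
  have hrkM : ∀ v, rk v + 1 ≤ Fintype.card V := by
    intro v
    have : rk v < (Finset.univ : Finset V).card := by
      apply Finset.card_lt_card
      rw [Finset.ssubset_iff_of_subset (Finset.subset_univ _)]
      exact ⟨v, by simp, by simpa using h.irrefl v⟩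
    rw [Finset.card_univ] at this
    exact this
  obtain ⟨N, hN⟩ : ∃ N, ∀ v, d v ≤ N :=
    ⟨Finset.univ.sup d, fun v => Finset.le_sup (f := d) (Finset.mem_univ v)⟩
  let M := Fintype.card V + 1
  let ε : ℕ → ℕ := fun k => M ^ (N - k)
  have hεpos : ∀ k, 0 < ε k := fun k => Nat.pow_pos (Nat.succ_pos _)
  have hε : ∀ k, k + 1 ≤ N → ε k = M * ε (k + 1) := by
    intro k hk
    simp only [ε]
    rw [← Nat.pow_succ']
    congr 1
    omega
  let g := levelHeight G d rk ε
  have hcomp : ∀ u v, u ≠ v → d u = d v → lt u v ∨ lt v u := by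
    intro u v hne huv
    exact h.comparable hne fun hadj => dist_ne_of_adj hG hb a hadj huv
  -- within a level, the heights increase along the order, by at least the spacing
  have hgap : ∀ k u v, d u = k → d v = k → lt u v → g k u + ε k ≤ g k v := by
    intro k u v hu hv huv
    have h1 := hrk u v huv
    have h2 : (rk u + 1) * ε k + ε k ≤ (rk v + 1) * ε k := by
      have : (rk u + 1 + 1) * ε k ≤ (rk v + 1) * ε k := Nat.mul_le_mul_right _ (by omega)
      linarith
    cases k with
    | zero => exact h2
    | succ k =>
      have h3 : (Finset.univ.filter fun w => d w = k ∧ ¬ G.Adj w u).sup (g k) ≤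
          (Finset.univ.filter fun w => d w = k ∧ ¬ G.Adj w v).sup (g k) := by
        apply Finset.sup_mono
        intro w hw
        simp only [Finset.mem_filter, Finset.mem_univ, true_and] at hw ⊢
        refine ⟨hw.1, fun hwv => hw.2 (h.adj_of_lt_left hG ha huv hwv ?_)⟩
        change d u = d w + 1
        omega
      change _ + _ + _ ≤ _ + _
      change (Finset.univ.filter fun w => d w = k ∧ ¬ G.Adj w u).sup (g k) + _ + _ ≤
        (Finset.univ.filter fun w => d w = k ∧ ¬ G.Adj w v).sup (g k) + _
      omega
  have hpos : ∀ k u, ε k ≤ g k u := by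
    intro k u
    have h1 : ε k ≤ (rk u + 1) * ε k := Nat.le_mul_of_pos_left _ (by omega)
    cases k with
    | zero => exact h1
    | succ k => exact h1.trans (Nat.le_add_left _ _)
  -- between consecutive levels, the heights detect adjacency
  have hnon : ∀ k u v, d u = k → d v = k + 1 → ¬ G.Adj u v → g k u < g (k + 1) v := by
    intro k u v hu hv huv
    have h1 : g k u ≤ (Finset.univ.filter fun w => d w = k ∧ ¬ G.Adj w v).sup (g k) :=
      Finset.le_sup (f := g k) (by simp [hu, huv])
    have h2 := hεpos (k + 1)
    have h3 : ε (k + 1) ≤ (rk v + 1) * ε (k + 1) := Nat.le_mul_of_pos_left _ (by omega)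
    change g k u < (Finset.univ.filter fun w => d w = k ∧ ¬ G.Adj w v).sup (g k) + _
    omega
  have hadj : ∀ k u v, d u = k → d v = k + 1 → G.Adj u v → g (k + 1) v < g k u := by
    intro k u v hu hv huv
    have h1 : (Finset.univ.filter fun w => d w = k ∧ ¬ G.Adj w v).sup (g k) + ε k ≤ g k u := by
      rcases (Finset.univ.filter fun w => d w = k ∧ ¬ G.Adj w v).eq_empty_or_nonempty with
        he | hne
      · rw [he]
        simpa using hpos k u
      · obtain ⟨w, hw, hws⟩ := Finset.exists_mem_eq_sup _ hne (g k)
        simp only [Finset.mem_filter, Finset.mem_univ, true_and] at hw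
        rw [hws]
        apply hgap k w u hw.1 hu
        have hwu : w ≠ u := by rintro rfl; exact hw.2 huv
        rcases hcomp w u hwu (by omega) with h2 | h2
        · exact h2
        · exact absurd (h.adj_of_lt_right hG ha h2 huv (by change d v = d w + 1; omega)) hw.2
    have h2 := hε k (by have := hN v; omega)
    have h3 : (rk v + 1) * ε (k + 1) ≤ Fintype.card V * ε (k + 1) :=
      Nat.mul_le_mul_right _ (hrkM v)
    have h4 := hεpos (k + 1)
    have h5 : M * ε (k + 1) = Fintype.card V * ε (k + 1) + ε (k + 1) := by
      simp only [M]; ring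
    change (Finset.univ.filter fun w => d w = k ∧ ¬ G.Adj w v).sup (g k) + _ < g k u
    omega
  have key : ∀ u v, d v = d u + 1 → (G.Adj u v ↔ g (d v) v < g (d u) u) := by
    intro u v huv
    constructor
    · intro h1
      have := hadj (d u) u v rfl huv h1
      rwa [huv]
    · intro h1
      by_contra h2
      have := hnon (d u) u v rfl huv h2
      rw [huv] at h1
      omega
  refine ⟨fun v => g (d v) v, ?_, ?_, ?_, ?_⟩
  · intro u v
    constructor
    · intro huv
      rcases dist_succ_or_of_adj hG hb a huv with h1 | h1
      · exact Or.inl ⟨h1, (key u v h1).1 huv⟩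
      · exact Or.inr ⟨h1, (key v u h1).1 huv.symm⟩
    · rintro (⟨h1, h2⟩ | ⟨h1, h2⟩)
      · exact (key u v h1).2 h2
      · exact ((key v u h1).2 h2).symm
  · rintro u v hne (h1 | h1) he
    · rcases hcomp u v hne h1 with h2 | h2
      · have := hgap (d u) u v rfl h1.symm h2
        have := hεpos (d u)
        rw [h1] at *
        omega
      · have := hgap (d u) v u h1.symm rfl h2
        have := hεpos (d u)
        rw [h1] at *
        omega
    · by_cases h2 : G.Adj u v
      · have := (key u v h1).1 h2
        omega
      · have := hnon (d u) u v rfl h1 h2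
        rw [← h1] at this
        omega
  · intro v
    simp only [hd]
    rw [hG.dist_eq_zero_iff, eq_comm]
  · intro v k hv
    exact exists_adj_dist_eq hG a hv

namespace LevelRep

variable {V : Type*} {G : SimpleGraph V} {r : V} {l h : V → ℕ}

/-- Moving the root. A vertex `y` of level `1` whose only neighbour is the root can be
made the new root, the old root being then the only vertex on level `1`. -/
theorem exists_reroot [Finite V] (R : LevelRep G r l h) {y : V} (hy : l y = 1)
    (hup : ∀ z, l z = 2 → ¬ G.Adj y z) :
    ∃ h', LevelRep G y (open Classical in fun v => if v = y then 0 else l v + 1) h' := by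
  classical
  have := Fintype.ofFinite V
  have hr : ∀ v, G.Adj y v ↔ v = r := by
    intro v
    constructor
    · intro hv
      rcases (R.adj_iff y v).1 hv with h1 | h1
      · exact absurd hv (hup v (by omega))
      · exact (R.level_zero v).1 (by omega)
    · rintro rfl
      obtain ⟨u, hu, huy⟩ := R.parent y 0 (by omega)
      rw [(R.level_zero u).1 hu] at huy
      exact huy.symm
  have hlr : l r = 0 := (R.level_zero r).2 rfl
  obtain ⟨B, hB⟩ : ∃ B, ∀ v, h v < B :=
    ⟨Finset.univ.sup h + 1, fun v => Nat.lt_succ_of_le (Finset.le_sup (f := h) (by simp))⟩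
  refine ⟨fun v => if v = y then B else h v, ?_, ?_, ?_, ?_⟩
  · intro u v
    by_cases hu : u = y <;> by_cases hv : v = y
    · subst hu; subst hv; simp
    · subst hu
      rw [hr]
      have := hB v
      have := R.level_zero v
      simp [hv]
      grind
    · subst hv
      rw [G.adj_comm, hr]
      have := hB u
      have := R.level_zero u
      simp [hu]
      grind
    · rw [R.adj_iff]
      simp [hu, hv]
  · intro u v huv hl
    by_cases hu : u = y <;> by_cases hv : v = y
    · subst hu; subst hv; exact absurd rfl huv
    · have := hB v
      simp [hu, hv]; omega
    · have := hB u
      simp [hu, hv]; omega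
    · simp only [hu, hv, if_false] at hl ⊢
      exact R.height_ne u v huv (by omega)
  · intro v
    by_cases hv : v = y <;> simp [hv]
  · intro v k hk
    by_cases hv : v = y
    · simp [hv] at hk
    · simp only [hv, if_false] at hk
      by_cases hvr : v = r
      · subst hvr
        exact ⟨y, by simp; omega, (hr v).2 rfl⟩
      · have h0 : l v ≠ 0 := fun h0 => hvr ((R.level_zero v).1 h0)
        obtain ⟨u, hu, huv⟩ := R.parent v (l v - 1) (by omega)
        have huy : u ≠ y := by
          rintro rfl
          exact hvr ((hr v).1 huv)
        exact ⟨u, by simp only [huy, if_false]; omega, huv⟩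

/-- The root can be chosen such that level `1` is a single vertex or all its vertices have
neighbours on level `2`. -/
theorem exists_good_root [Finite V] (R : LevelRep G r l h) :
    ∃ r' l' h', LevelRep G r' l' h' ∧ ∀ y y', l' y = 1 → l' y' = 1 → y ≠ y' →
      ∃ z, l' z = 2 ∧ G.Adj y z := by
  classical
  by_cases hc : ∃ y, l y = 1 ∧ ∀ z, l z = 2 → ¬ G.Adj y z
  · obtain ⟨y, hy, hup⟩ := hc
    obtain ⟨h', R'⟩ := R.exists_reroot hy hup
    refine ⟨y, _, h', R', ?_⟩
    intro u v hu hv huv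
    exfalso
    apply huv
    have : ∀ w, (if w = y then 0 else l w + 1) = 1 → w = r := by
      intro w hw
      split_ifs at hw
      exact (R.level_zero w).1 (by omega)
    rw [this u hu, this v hv]
  · push Not at hc
    exact ⟨r, l, h, R, fun y _ hy _ _ => hc y hy⟩

end LevelRep

end SimpleGraph

namespace SimpleGraph

/-! ### Double-ended forks -/

section Fork

variable {n : ℕ}

theorem doubleEndedFork_adj_inl_inl (i j : Fin (n + 1)) :
    (doubleEndedFork n).Adj (.inl i) (.inl j) ↔ i.val + 1 = j.val ∨ j.val + 1 = i.val := by
  simp only [doubleEndedFork, fromRel_adj, doubleEndedForkRel]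
  constructor
  · exact fun h => h.2
  · intro h
    refine ⟨?_, h⟩
    rintro ⟨⟩
    omega

theorem doubleEndedFork_adj_inl_false (i : Fin (n + 1)) (b : Bool) :
    (doubleEndedFork n).Adj (.inl i) (.inr (false, b)) ↔ i.val = 0 := by
  simp [doubleEndedFork, fromRel_adj, doubleEndedForkRel]

theorem doubleEndedFork_adj_inl_true (i : Fin (n + 1)) (b : Bool) :
    (doubleEndedFork n).Adj (.inl i) (.inr (true, b)) ↔ i.val = n := by
  simp [doubleEndedFork, fromRel_adj, doubleEndedForkRel, Fin.ext_iff]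

theorem not_doubleEndedFork_adj_inr_inr (x y : Bool × Bool) :
    ¬ (doubleEndedFork n).Adj (.inr x) (.inr y) := by
  simp [doubleEndedFork, fromRel_adj, doubleEndedForkRel]

/-- A path `p 0, …, p n` and four leaves `x c b` with the adjacencies of a double-ended fork give
an embedding. -/
theorem exists_fork_embedding {V : Type*} {G : SimpleGraph V} (n : ℕ) (p : ℕ → V)
    (x : Bool → Bool → V)
    (hpp : ∀ a b, a ≤ n → b ≤ n → (G.Adj (p a) (p b) ↔ a + 1 = b ∨ b + 1 = a))
    (hpi : ∀ a b, a ≤ n → b ≤ n → p a = p b → a = b)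
    (h0 : ∀ a b, a ≤ n → (G.Adj (p a) (x false b) ↔ a = 0))
    (h1 : ∀ a b, a ≤ n → (G.Adj (p a) (x true b) ↔ a = n))
    (hxx : ∀ c b c' b', ¬ G.Adj (x c b) (x c' b'))
    (hpx : ∀ a c b, a ≤ n → p a ≠ x c b)
    (hxi : ∀ c b c' b', x c b = x c' b' → c = c' ∧ b = b') :
    ∃ f : doubleEndedFork n ↪g G, (∀ i, f (.inl i) = p i) ∧ ∀ c b, f (.inr (c, b)) = x c b := by
  refine ⟨⟨⟨fun v => Sum.elim (fun i : Fin (n + 1) => p i) (fun q => x q.1 q.2) v, ?_⟩, ?_⟩,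
    fun i => rfl, fun c b => rfl⟩
  · rintro (i | ⟨c, b⟩) (j | ⟨c', b'⟩) h
    · have := hpi _ _ (by omega) (by omega) h
      rw [Fin.ext this]
    · exact absurd h (hpx _ _ _ (by omega))
    · exact absurd h.symm (hpx _ _ _ (by omega))
    · obtain ⟨rfl, rfl⟩ := hxi _ _ _ _ h
      rfl
  · have key : ∀ (i : Fin (n + 1)) c b, G.Adj (p i) (x c b) ↔
        (doubleEndedFork n).Adj (.inl i) (.inr (c, b)) := by
      rintro i (_ | _) b
      · rw [h0 _ _ (by omega), doubleEndedFork_adj_inl_false]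
      · rw [h1 _ _ (by omega), doubleEndedFork_adj_inl_true]
    rintro (i | ⟨c, b⟩) (j | ⟨c', b'⟩)
    · change G.Adj (p i) (p j) ↔ _
      rw [hpp _ _ (by omega) (by omega), doubleEndedFork_adj_inl_inl]
    · exact key i c' b'
    · rw [adj_comm, (doubleEndedFork n).adj_comm]
      exact key j c b
    · exact iff_of_false (hxx _ _ _ _) (not_doubleEndedFork_adj_inr_inr _ _)

end Fork

namespace LevelRep

variable {V : Type*} {G : SimpleGraph V} {r : V} {l h : V → ℕ}

theorem level_of_adj (R : LevelRep G r l h) {u v : V} (huv : G.Adj u v) :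
    l v = l u + 1 ∨ l u = l v + 1 := by
  rcases (R.adj_iff u v).1 huv with h1 | h1
  · exact Or.inl h1.1
  · exact Or.inr h1.1

theorem exists_level_eq (R : LevelRep G r l h) {v : V} {k : ℕ} (hk : k ≤ l v) :
    ∃ u, l u = k := by
  obtain ⟨m, hm⟩ := Nat.exists_eq_add_of_le hk
  induction m generalizing v with
  | zero => exact ⟨v, hm⟩
  | succ m ih =>
    obtain ⟨u, hu, -⟩ := R.parent v (k + m) hm
    exact ih (by omega) hu

/-- The highest vertex of a level is adjacent to the whole next level. -/
theorem exists_top [Finite V] (R : LevelRep G r l h) {v : V} {k : ℕ} (hk : k ≤ l v) :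
    ∃ t, l t = k ∧ ∀ w, l w = k + 1 → G.Adj t w := by
  classical
  have := Fintype.ofFinite V
  obtain ⟨u, hu⟩ := R.exists_level_eq hk
  obtain ⟨t, ht, hmax⟩ := (Finset.univ.filter fun w => l w = k).exists_max_image h
    ⟨u, by simpa using hu⟩
  simp only [Finset.mem_filter, Finset.mem_univ, true_and] at ht hmax
  refine ⟨t, ht, fun w hw => ?_⟩
  obtain ⟨z, hz, hzw⟩ := R.parent w k hw
  have h1 := hmax z hz
  rcases (R.adj_iff z w).1 hzw with h2 | h2
  · exact (R.adj_iff t w).2 (Or.inl ⟨by omega, by omega⟩)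
  · omega

/-- A path `t c, …, t e` through consecutive levels, with two leaves `x₀`, `x₁` at its start and two
vertices `z₀`, `z₁` of the next level at its end, spans a double-ended fork. The leaves at the start
may lie on level `c - 1` or `c + 1`, so non-adjacency to the path has to be assumed for its next two
vertices only. -/
theorem fork_of_path (R : LevelRep G r l h) (t : ℕ → V) {c e : ℕ} (hce : c < e)
    (hlt : ∀ k, c ≤ k → k ≤ e → l (t k) = k)
    (hadj : ∀ k, c ≤ k → k < e → G.Adj (t k) (t (k + 1)))
    {x₀ x₁ z₀ z₁ : V} (hx : x₀ ≠ x₁) (hz : z₀ ≠ z₁)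
    (hx₀ : G.Adj (t c) x₀) (hx₁ : G.Adj (t c) x₁) (hxx : ¬ G.Adj x₀ x₁)
    (hxn : ∀ x, x = x₀ ∨ x = x₁ → (l x ≤ c + 1 ∧ c ≤ l x + 1 ∧ ¬ G.Adj x (t (c + 1)) ∧
      ¬ G.Adj x (t (c + 2)) ∧ x ≠ t (c + 1) ∧ (l x = c + 1 → c + 1 < e)))
    (hz₀ : G.Adj (t e) z₀) (hz₁ : G.Adj (t e) z₁) (hlz₀ : l z₀ = e + 1) (hlz₁ : l z₁ = e + 1) :
    ∃ f : doubleEndedFork (e - c) ↪g G, ∀ v, c ≤ l (f v) + 1 := by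
  have hx0l := R.level_of_adj hx₀
  have hx1l := R.level_of_adj hx₁
  have hlc := hlt c le_rfl hce.le
  have hxn0 := hxn x₀ (Or.inl rfl)
  have hxn1 := hxn x₁ (Or.inr rfl)
  let x : Bool → Bool → V := fun a b => if a then (if b then z₁ else z₀) else if b then x₁ else x₀
  have hxf : ∀ b, x false b = x₀ ∨ x false b = x₁ := by intro b; cases b <;> simp [x]
  have hxt : ∀ b, l (x true b) = e + 1 ∧ G.Adj (t e) (x true b) := by
    intro b; cases b <;> simp [x, hz₀, hz₁, hlz₀, hlz₁]
  have hxc : ∀ b, G.Adj (t c) (x false b) := by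
    intro b; cases b <;> simp [x, hx₀, hx₁]
  have hlev := fun {u v} => R.level_of_adj (u := u) (v := v)
  have hemb : ∃ f : doubleEndedFork (e - c) ↪g G, (∀ i, f (.inl i) = t (c + i)) ∧
      ∀ a b, f (.inr (a, b)) = x a b := by
    refine exists_fork_embedding (G := G) (e - c) (fun k => t (c + k)) x ?_ ?_ ?_ ?_ ?_ ?_ ?_
    · intro a b ha hb
      have h1 := hlt (c + a) (by omega) (by omega)
      have h2 := hlt (c + b) (by omega) (by omega)
      constructor
      · intro h3
        have := hlev h3
        omega
      · rintro (rfl | rfl)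
        · exact hadj (c + a) (by omega) (by omega)
        · exact (hadj (c + b) (by omega) (by omega)).symm
    · intro a b ha hb hab
      have h1 := hlt (c + a) (by omega) (by omega)
      have h2 := hlt (c + b) (by omega) (by omega)
      rw [hab] at h1
      omega
    · intro a b ha
      constructor
      · intro h1
        by_contra h0
        have h2 := hlt (c + a) (by omega) (by omega)
        obtain ⟨h3, h4, h5, h6, -, -⟩ := hxn _ (hxf b)
        have := hlev h1
        have h7 : a = 1 ∨ a = 2 := by omega
        rcases h7 with rfl | rfl
        · exact h5 h1.symm
        · exact h6 h1.symm
      · rintro rfl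
        exact hxc b
    · intro a b ha
      constructor
      · intro h1
        have h2 := hlt (c + a) (by omega) (by omega)
        have := hlev h1
        have := (hxt b).1
        omega
      · rintro rfl
        have := (hxt b).2
        rwa [show c + (e - c) = e by omega]
    · have hft : ∀ b b', ¬ G.Adj (x false b) (x true b') := by
        intro b b' h1
        obtain ⟨h3, -, -, -, -, h6⟩ := hxn _ (hxf b)
        have := hlev h1
        have := (hxt b').1
        omega
      intro a b a' b' h1
      cases a <;> cases a'
      · have h2 := hlev h1
        rcases hxf b with h3 | h3 <;> rcases hxf b' with h4 | h4 <;> rw [h3, h4] at h1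
        · exact G.loopless.irrefl _ h1
        · exact hxx h1
        · exact hxx h1.symm
        · exact G.loopless.irrefl _ h1
      · exact hft _ _ h1
      · exact hft _ _ h1.symm
      · have h2 := hlev h1
        have := (hxt b).1
        have := (hxt b').1
        omega
    · intro a d b ha h1
      have h2 := hlt (c + a) (by omega) (by omega)
      rw [h1] at h2
      cases d
      · obtain ⟨h3, h4, h5, h6, h7, -⟩ := hxn _ (hxf b)
        have h8 := hlev (hxc b)
        have : a = 1 := by omega
        subst this
        exact h7 h1.symm
      · have := (hxt b).1
        omega
    · have hft : ∀ b b', x false b ≠ x true b' := by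
        intro b b' h1
        obtain ⟨h3, -, -, -, -, h6⟩ := hxn _ (hxf b)
        have := (hxt b').1
        rw [← h1] at this
        omega
      intro a b a' b' h1
      cases a <;> cases a'
      · refine ⟨rfl, ?_⟩
        cases b <;> cases b' <;> simp [x] at h1 ⊢
        · exact hx h1
        · exact hx h1.symm
      · exact absurd h1 (hft _ _)
      · exact absurd h1.symm (hft _ _)
      · refine ⟨rfl, ?_⟩
        cases b <;> cases b' <;> simp [x] at h1 ⊢
        · exact hz h1
        · exact hz h1.symm
  obtain ⟨f, hf1, hf2⟩ := hemb
  refine ⟨f, ?_⟩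
  rintro (i | ⟨a, b⟩)
  · rw [hf1, hlt _ (by omega) (by omega)]; omega
  · rw [hf2]
    cases a
    · exact (hxn _ (hxf b)).2.1
    · have := (hxt b).1; omega

/-- Two levels `i + 3 ≤ j` with at least two vertices each give a double-ended fork, whose
length is `j - i` or `j - i - 2`. The vertices of maximal height form its path. -/
theorem exists_fork [Finite V] (R : LevelRep G r l h) {i j : ℕ} (hi : 1 ≤ i) (hij : i + 3 ≤ j)
    {x x' z z' : V} (hx : x ≠ x') (hlx : l x = i) (hlx' : l x' = i)
    (hz : z ≠ z') (hlz : l z = j) (hlz' : l z' = j)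
    (h2 : 2 ≤ i ∨ ∀ y w, l y = 1 → l w = 2 → G.Adj y w) :
    ∃ n, j ≤ n + i + 2 ∧ ∃ f : doubleEndedFork n ↪g G, ∀ v, i ≤ l (f v) + 2 := by
  have htop : ∀ k, ∃ t, k ≤ j → (l t = k ∧ ∀ w, l w = k + 1 → G.Adj t w) := by
    intro k
    by_cases hk : k ≤ j
    · obtain ⟨t, ht⟩ := R.exists_top (v := z) (k := k) (by omega)
      exact ⟨t, fun _ => ht⟩
    · exact ⟨r, fun h => absurd h hk⟩
  choose t ht using htop
  have hlev := fun {u v} => R.level_of_adj (u := u) (v := v)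
  obtain ⟨e, rfl⟩ : ∃ e, j = e + 1 := ⟨j - 1, by omega⟩
  obtain ⟨y, hy, hly⟩ : ∃ y, y ≠ t i ∧ l y = i := by
    by_cases h1 : x = t i
    · exact ⟨x', h1 ▸ hx.symm, hlx'⟩
    · exact ⟨x, h1, hlx⟩
  have hlt : ∀ k, k ≤ e → l (t k) = k := fun k hk => (ht k (by omega)).1
  have hadj : ∀ k, k < e → G.Adj (t k) (t (k + 1)) :=
    fun k hk => (ht k (by omega)).2 _ (hlt (k + 1) hk)
  have hzz := (ht e (by omega)).2 z hlz
  have hzz' := (ht e (by omega)).2 z' hlz'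
  have hsame : ∀ {u v}, l u = l v → ¬ G.Adj u v := by
    intro u v huv h1
    have := hlev h1
    omega
  by_cases hcase : G.Adj y (t (i + 1))
  · obtain ⟨f, hf⟩ := R.fork_of_path t (c := i + 1) (e := e) (by omega)
      (fun k _ hk => hlt k hk) (fun k _ hk => hadj k hk) hy.symm hz
      (hadj i (by omega)).symm hcase.symm
      (hsame (by rw [hly, hlt i (by omega)]))
      (by
        have h3 : ∀ w, l w = i → (l w ≤ i + 1 + 1 ∧ i + 1 ≤ l w + 1 ∧ ¬ G.Adj w (t (i + 1 + 1)) ∧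
            ¬ G.Adj w (t (i + 1 + 2)) ∧ w ≠ t (i + 1 + 1) ∧ (l w = i + 1 + 1 → i + 1 + 1 < e)) := by
          intro w hw
          have h4 := hlt (i + 2) (by omega)
          have h5 := (ht (i + 3) (by omega)).1
          refine ⟨by omega, by omega, fun h6 => ?_, fun h6 => ?_, ?_, by omega⟩
          · have := hlev h6
            simp only [Nat.add_assoc] at this
            norm_num at this
            omega
          · have := hlev h6
            simp only [Nat.add_assoc] at this
            norm_num at this
            omega
          · rintro rfl
            simp only [Nat.add_assoc] at hw
            norm_num at hw
            omega
        rintro w (rfl | rfl)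
        · exact h3 _ (hlt i (by omega))
        · exact h3 _ hly)
      hzz hzz' hlz hlz'
    exact ⟨e - (i + 1), by omega, f, fun v => by have := hf v; omega⟩
  · have hi2 : 2 ≤ i := by
      rcases h2 with h2 | h2
      · exact h2
      · by_contra h3
        have hi1 : i = 1 := by omega
        subst hi1
        exact hcase (h2 y _ hly (hlt 2 (by omega)))
    obtain ⟨c, rfl⟩ : ∃ c, i = c + 2 := ⟨i - 2, by omega⟩
    have hlc := hlt c (by omega)
    have hlc1 := hlt (c + 1) (by omega)
    have hlc2 := hlt (c + 2) (by omega)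
    have hlc3 := hlt (c + 3) (by omega)
    obtain ⟨f, hf⟩ := R.fork_of_path t (c := c + 1) (e := e) (by omega)
      (fun k _ hk => hlt k hk) (fun k _ hk => hadj k hk) (x₀ := y) (x₁ := t c)
      (by rintro rfl; omega) hz ((ht (c + 1) (by omega)).2 y hly) (hadj c (by omega)).symm
      (fun h6 => by have := hlev h6; omega)
      (by
        rintro w (rfl | rfl)
        · exact ⟨by omega, by omega, hsame (by rw [hly, hlc2]), hcase, hy, by omega⟩
        · refine ⟨by omega, by omega, fun h6 => ?_, fun h6 => ?_, fun h6 => ?_, by omega⟩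
          · have := hlev h6
            change l (t (c + 2)) = _ ∨ _ = l (t (c + 2)) + 1 at this
            omega
          · have := hlev h6
            change l (t (c + 3)) = _ ∨ _ = l (t (c + 3)) + 1 at this
            omega
          · have h7 : l (t c) = l (t (c + 2)) := by rw [h6]
            omega)
      hzz hzz' hlz hlz'
    exact ⟨e - (c + 1), by omega, f, fun v => by have := hf v; omega⟩

end LevelRep

end SimpleGraph

namespace SimpleGraph

/-! ### Connected graphs with a bounded window are well-quasi-ordered -/

namespace LevelRep

variable {V V' : Type*} {G : SimpleGraph V} {r : V} {l h : V → ℕ}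
  {G' : SimpleGraph V'} {r' : V'} {l' h' : V' → ℕ}

/-- Consecutive levels are completely joined if the lower one is a single vertex. -/
theorem adj_of_single (R : LevelRep G r l h) {u v : V} (huv : l v = l u + 1)
    (hu : ∀ w, l w = l u → w = u) : G.Adj u v := by
  obtain ⟨w, hw, hwv⟩ := R.parent v (l u) huv
  rwa [hu w hw] at hwv

/-- Two graphs whose levels outside a window of length `M` are single vertices: an embedding
`ψ` of the windows extends to an embedding of the graphs if the first graph has at most as many
levels below and above the window. -/
theorem embeds_of_window (R : LevelRep G r l h) (R' : LevelRep G' r' l' h') {c c' M : ℕ}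
    (hs : ∀ u v, l u = l v → (l u < c ∨ c + M ≤ l u + 1) → u = v)
    (hs' : ∀ u v, l' u = l' v → (l' u < c' ∨ c' + M ≤ l' u + 1) → u = v)
    (hN : ∀ v, ∃ v', l' v' + c = l v + c') (ψ : V → V')
    (hψ : ∀ v, c ≤ l v → l v < c + M → l' (ψ v) + c = l v + c')
    (hinj : ∀ u v, ψ u = ψ v → u = v)
    (hord : ∀ u v, c ≤ l u → l v = l u + 1 → l v < c + M → (h v < h u ↔ h' (ψ v) < h' (ψ u))) :
    G.IsIndContained G' := by
  classical
  choose τ hτ using hN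
  let f : V → V' := fun v => if c ≤ l v ∧ l v < c + M then ψ v else τ v
  have hf : ∀ v, l' (f v) + c = l v + c' := by
    intro v
    simp only [f]
    split_ifs with hv
    · exact hψ v hv.1 hv.2
    · exact hτ v
  have hup : ∀ u v, l v = l u + 1 → (G'.Adj (f u) (f v) ↔ G.Adj u v) := by
    intro u v huv
    have h1 := hf u
    have h2 := hf v
    by_cases hw : c ≤ l u ∧ l v < c + M
    · have hfu : f u = ψ u := if_pos ⟨hw.1, by omega⟩
      have hfv : f v = ψ v := if_pos ⟨by omega, hw.2⟩
      have h3 := hord u v hw.1 huv hw.2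
      rw [R.adj_iff, R'.adj_iff, hfu, hfv, h3]
      rw [hfu] at h1
      rw [hfv] at h2
      constructor
      · rintro (⟨h4, h5⟩ | ⟨h4, h5⟩)
        · exact Or.inl ⟨huv, h5⟩
        · omega
      · rintro (⟨h4, h5⟩ | ⟨h4, h5⟩)
        · exact Or.inl ⟨by omega, h5⟩
        · omega
    · refine iff_of_true ?_ ?_
      · exact R'.adj_of_single (by omega) fun w hw => hs' _ _ hw (by omega)
      · exact R.adj_of_single huv fun w hw => hs _ _ hw (by omega)
  refine ⟨⟨⟨f, ?_⟩, ?_⟩⟩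
  · intro u v huv
    have h1 := hf u
    have h2 := hf v
    rw [huv] at h1
    by_cases hw : c ≤ l u ∧ l u < c + M
    · have hfu : f u = ψ u := if_pos hw
      have hfv : f v = ψ v := if_pos ⟨by omega, by omega⟩
      exact hinj _ _ (by rw [← hfu, ← hfv, huv])
    · exact hs _ _ (by omega) (by omega)
  · intro u v
    change G'.Adj (f u) (f v) ↔ G.Adj u v
    have h1 := hf u
    have h2 := hf v
    by_cases h3 : l v = l u + 1
    · exact hup u v h3
    · by_cases h4 : l u = l v + 1
      · rw [G'.adj_comm, G.adj_comm]
        exact hup v u h4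
      · refine iff_of_false (fun h5 => ?_) (fun h5 => ?_)
        · have := R'.level_of_adj h5
          omega
        · have := R.level_of_adj h5
          omega

end LevelRep

end SimpleGraph

namespace FinGraph

open SimpleGraph

theorem exists_strictMono_of_sublistForall₂_ofFn {α : Type*} {R : α → α → Prop} {m n : ℕ}
    {a : Fin m → α} {b : Fin n → α} (h : List.SublistForall₂ R (List.ofFn a) (List.ofFn b)) :
    ∃ g : Fin m → Fin n, StrictMono g ∧ ∀ i, R (a i) (b (g i)) := by
  obtain ⟨w, hw1, hw2⟩ := List.sublistForall₂_iff.1 h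
  obtain ⟨φ, hφ⟩ := List.sublist_iff_exists_orderEmbedding_getElem?_eq.1 hw2
  obtain ⟨hlen, hR⟩ := List.forall₂_iff_get.1 hw1
  rw [List.length_ofFn] at hlen
  have key : ∀ i : Fin m, ∃ k : Fin n, φ i = k ∧ R (a i) (b k) := by
    intro i
    have h1 := hφ i
    have h2 := hR i (by simp) (by omega)
    rw [List.getElem?_eq_getElem (by omega), List.getElem?_ofFn] at h1
    split_ifs at h1 with h3
    · refine ⟨⟨φ i, h3⟩, rfl, ?_⟩
      have h4 := Option.some.inj h1
      simpa [h4] using h2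
  choose g hg hgR using key
  refine ⟨g, fun i j hij => ?_, hgR⟩
  rw [Fin.lt_def, ← hg, ← hg]
  exact φ.strictMono hij

/-- `H` has a level representation in which the levels outside a window `c, …, c + M - 1`, and
the last level of the window, have at most one vertex. -/
def HasWindow (M : ℕ) (H : FinGraph) : Prop :=
  ∃ (r : Fin H.1) (l h : Fin H.1 → ℕ) (c : ℕ), LevelRep H.2 r l h ∧
    (∃ w, l w = c) ∧ ∀ u v, l u = l v → (l u < c ∨ c + M ≤ l u + 1) → u = v

/-- The vertices in the window, sorted by height and labelled by their levels, form a word over a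
finite alphabet which, together with the numbers of levels below and above the window, determines
the graph; so Higman's lemma applies. -/
theorem partiallyWellOrderedOn_hasWindow (M : ℕ) :
    {H : FinGraph | HasWindow M H}.PartiallyWellOrderedOn Embeds := by
  classical
  rw [Set.partiallyWellOrderedOn_iff_exists_lt]
  intro F hF
  choose r l h c R hw₀ hs using hF
  choose w₀ hw₀ using hw₀
  let letter : (n : ℕ) → Fin (F n).1 → ℕ := fun n v =>
    if c n ≤ l n v ∧ l n v < c n + M then l n v - c n else M
  let word : ℕ → List ℕ := fun n =>
    List.ofFn fun k => letter n (Tuple.sort (h n) k)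
  let top : ℕ → ℕ := fun n => Finset.univ.sup (l n)
  have hpwo : ((Set.univ : Set ℕ) ×ˢ ((Set.univ : Set ℕ) ×ˢ
      {w : List ℕ | ∀ x, x ∈ w → x ∈ Set.Iic M})).PartiallyWellOrderedOn
      fun x y : ℕ × ℕ × List ℕ => x.1 ≤ y.1 ∧ x.2.1 ≤ y.2.1 ∧
        List.SublistForall₂ (· = ·) x.2.2 y.2.2 := by
    have hN : (Set.univ : Set ℕ).PartiallyWellOrderedOn (· ≤ ·) :=
      Set.partiallyWellOrderedOn_univ_iff.2 wellQuasiOrdered_le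
    exact hN.prod (hN.prod
      (Set.PartiallyWellOrderedOn.partiallyWellOrderedOn_sublistForall₂ _
        (Set.finite_Iic M).partiallyWellOrderedOn))
  obtain ⟨m, n, hmn, hc, ht, hw⟩ := hpwo.exists_lt
    (f := fun n => (c n, top n - c n, word n)) (by
      intro n
      refine ⟨trivial, trivial, ?_⟩
      intro x hx
      obtain ⟨k, rfl⟩ := (List.mem_ofFn' _ _).1 hx
      simp only [letter, Set.mem_Iic]
      split_ifs <;> omega)
  refine ⟨m, n, hmn, ?_⟩
  simp only at hc ht hw
  obtain ⟨g, hgm, hlet⟩ := exists_strictMono_of_sublistForall₂_ofFn hw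
  replace hgm : ∀ a b, g a < g b ↔ a < b := fun a b => hgm.lt_iff_lt
  let ψ : Fin (F m).1 → Fin (F n).1 := fun v =>
    Tuple.sort (h n) (g ((Tuple.sort (h m)).symm v))
  have hψlet : ∀ v, letter n (ψ v) = letter m v := by
    intro v
    simp only [ψ]
    rw [← hlet, Equiv.apply_symm_apply]
  have hψ : ∀ v, c m ≤ l m v → l m v < c m + M → l n (ψ v) + c m = l m v + c n := by
    intro v h1 h2
    have h3 := hψlet v
    have h4 : letter m v = l m v - c m := if_pos ⟨h1, h2⟩
    rw [h4] at h3
    simp only [letter] at h3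
    split_ifs at h3 <;> omega
  refine LevelRep.embeds_of_window (R m) (R n) (hs m) (hs n) ?_ ψ hψ ?_ ?_
  · intro v
    have h1 : l m v ≤ top m := Finset.le_sup (f := l m) (Finset.mem_univ v)
    have h2 : c n ≤ top n := hw₀ n ▸ Finset.le_sup (f := l n) (Finset.mem_univ (w₀ n))
    obtain ⟨z, -, hz⟩ := Finset.exists_mem_eq_sup Finset.univ ⟨w₀ n, Finset.mem_univ _⟩ (l n)
    change top n = _ at hz
    obtain ⟨v', hv'⟩ := (R n).exists_level_eq (v := z) (k := l m v + (c n - c m)) (by omega)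
    exact ⟨v', by omega⟩
  · intro u v huv
    have h1 := (Tuple.sort (h n)).injective huv
    have h2 : (Tuple.sort (h m)).symm u = (Tuple.sort (h m)).symm v := by
      apply le_antisymm
      · exact not_lt.1 fun h => absurd ((hgm _ _).2 h) (by rw [h1]; exact lt_irrefl _)
      · exact not_lt.1 fun h => absurd ((hgm _ _).2 h) (by rw [h1]; exact lt_irrefl _)
    exact (Tuple.sort (h m)).symm.injective h2
  · -- both heights are compared through positions in the sorted words
    have hpos : ∀ (n : ℕ) (a b : Fin (F n).1), h n (Tuple.sort (h n) a) ≠ h n (Tuple.sort (h n) b) →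
        (h n (Tuple.sort (h n) a) < h n (Tuple.sort (h n) b) ↔ a < b) := by
      intro n a b hab
      have hmono := Tuple.monotone_sort (h n)
      constructor
      · intro h1
        by_contra h2
        have := hmono (not_lt.1 h2)
        simp only [Function.comp] at this
        omega
      · intro h1
        have := hmono h1.le
        simp only [Function.comp] at this
        omega
    intro u v hu huv hv
    have h1 := hψ u hu (by omega)
    have h2 := hψ v (by omega) hv
    have hne : u ≠ v := by rintro rfl; omega
    have hne' : ψ u ≠ ψ v := by intro h3; rw [h3] at h1; omega
    have h3 := (R m).height_ne u v hne (Or.inr huv)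
    have h4 := (R n).height_ne _ _ hne' (Or.inr (by omega))
    have h5 := hpos m ((Tuple.sort (h m)).symm v) ((Tuple.sort (h m)).symm u)
    rw [Equiv.apply_symm_apply, Equiv.apply_symm_apply] at h5
    rw [h5 h3.symm, hpos n _ _ h4.symm, hgm]

end FinGraph

namespace SimpleGraph

/-! ### Permutation graphs without long double-ended forks -/

theorem IsPermutationGraph.exists_order {V : Type*} {G : SimpleGraph V}
    (hG : G.IsPermutationGraph) : ∃ lt : V → V → Prop, IsIncomparabilityGraph G lt := by
  obtain ⟨L, σ, h⟩ := hG
  refine ⟨fun u v => L.lt u v ∧ L.lt (σ u) (σ v), ?_, ?_, ?_⟩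
  · exact fun v hv => lt_irrefl v hv.1
  · exact fun u v w h1 h2 => ⟨lt_trans h1.1 h2.1, lt_trans h1.2 h2.2⟩
  · intro u v
    rw [h]
    constructor
    · rintro (⟨h1, h2⟩ | ⟨h1, h2⟩)
      · exact ⟨ne_of_lt h1, fun h3 => lt_asymm h2 h3.2, fun h3 => lt_asymm h1 h3.1⟩
      · exact ⟨(ne_of_lt h1).symm, fun h3 => lt_asymm h1 h3.1, fun h3 => lt_asymm h2 h3.2⟩
    · rintro ⟨h1, h2, h3⟩
      have h1' : σ u ≠ σ v := fun h4 => h1 (σ.injective h4)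
      rcases lt_or_gt_of_ne h1 with h4 | h4
      · rcases lt_or_gt_of_ne h1' with h5 | h5
        · exact absurd ⟨h4, h5⟩ h2
        · exact Or.inl ⟨h4, h5⟩
      · rcases lt_or_gt_of_ne h1' with h5 | h5
        · exact Or.inr ⟨h4, h5⟩
        · exact absurd ⟨h4, h5⟩ h3

theorem IsIncomparabilityGraph.exists_minimal {V : Type*} [Finite V] [Nonempty V]
    {G : SimpleGraph V} {lt : V → V → Prop} (h : IsIncomparabilityGraph G lt) :
    ∃ a, ∀ v, ¬ lt v a := by
  have : IsTrans V lt := ⟨h.trans⟩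
  have : Std.Irrefl lt := ⟨h.irrefl⟩
  obtain ⟨a, -, ha⟩ := (Finite.wellFounded_of_trans_of_irrefl lt).has_min Set.univ
    Set.univ_nonempty
  exact ⟨a, fun v hv => ha v trivial hv⟩

/-- Embeddings of the components into distinct components give an embedding of the graph. -/
theorem isIndContained_of_components {V V' : Type*} {G : SimpleGraph V} {G' : SimpleGraph V'}
    (φ : G.ConnectedComponent → G'.ConnectedComponent) (hφ : Function.Injective φ)
    (he : ∀ c, (G.induce c.supp).IsIndContained (G'.induce (φ c).supp)) :
    G.IsIndContained G' := by
  have e := fun c => (he c).some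
  let f : V → V' := fun v => (e (G.connectedComponentMk v) ⟨v, rfl⟩).1
  have hf : ∀ (c : G.ConnectedComponent) (v : V) (hv : v ∈ c.supp), f v = (e c ⟨v, hv⟩).1 := by
    intro c v hv
    have hv' : G.connectedComponentMk v = c := hv
    subst hv'
    rfl
  have hcomp : ∀ v, G'.connectedComponentMk (f v) = φ (G.connectedComponentMk v) :=
    fun v => (e (G.connectedComponentMk v) ⟨v, rfl⟩).2
  refine ⟨⟨⟨f, ?_⟩, ?_⟩⟩
  · intro u v huv
    have h1 : G.connectedComponentMk v = G.connectedComponentMk u := by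
      apply hφ
      rw [← hcomp, ← hcomp, huv]
    rw [hf _ u rfl, hf _ v h1] at huv
    have := (e (G.connectedComponentMk u)).injective (Subtype.ext huv)
    exact congrArg Subtype.val this
  · intro u v
    change G'.Adj (f u) (f v) ↔ G.Adj u v
    by_cases h1 : G.connectedComponentMk v = G.connectedComponentMk u
    · rw [hf _ u rfl, hf _ v h1]
      exact (e (G.connectedComponentMk u)).map_adj_iff (v := ⟨u, rfl⟩) (w := ⟨v, h1⟩)
    · refine iff_of_false (fun h2 => h1 ?_) (fun h2 => h1 ?_)
      · apply hφ
        rw [← hcomp, ← hcomp]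
        exact (ConnectedComponent.sound h2.reachable).symm
      · exact (ConnectedComponent.sound h2.reachable).symm

/-- Every finite graph is isomorphic to a graph on some `Fin n`. -/
theorem exists_finGraph_iso {V : Type*} [Finite V] (G : SimpleGraph V) :
    ∃ H : FinGraph, Nonempty (H.2 ≃g G) := by
  obtain ⟨n, ⟨e⟩⟩ := Finite.exists_equiv_fin V
  exact ⟨⟨n, G.comap e.symm⟩, ⟨SimpleGraph.Iso.comap e.symm G⟩⟩

end SimpleGraph

namespace FinGraph

open SimpleGraph

instance : IsPreorder FinGraph Embeds where
  refl H := IsIndContained.refl H.2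
  trans _ _ _ h1 h2 := IsIndContained.trans h1 h2

/-- A connected bipartite permutation graph without long double-ended forks has a bounded window:
two far apart levels with at least two vertices each would give a long double-ended fork. -/
theorem hasWindow_of_forkFree {H : FinGraph} (hc : H.2.Connected) (hb : H.2.IsBipartite)
    (hp : H.2.IsPermutationGraph) {D : ℕ}
    (hD : ∀ n, D < n → ¬ (doubleEndedFork n).IsIndContained H.2) : HasWindow (D + 6) H := by
  classical
  obtain ⟨lt, hlt⟩ := hp.exists_order
  have := hc.nonempty
  obtain ⟨a, ha⟩ := hlt.exists_minimal
  obtain ⟨f, R₀⟩ := hlt.exists_levelRep hc hb ha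
  obtain ⟨r, l, h, R, hgood⟩ := R₀.exists_good_root
  by_cases hex : ∃ i, ∃ u v, u ≠ v ∧ l u = i ∧ l v = i
  · set i := Nat.find hex with hi
    obtain ⟨x, x', hx, hlx, hlx'⟩ := Nat.find_spec hex
    rw [← hi] at hlx hlx'
    have hmin : ∀ u v, l u = l v → l u < i → u = v := by
      intro u v huv hlt
      by_contra hne
      exact Nat.find_min hex hlt ⟨u, v, hne, rfl, huv.symm⟩
    refine ⟨r, l, h, i, R, ⟨x, hlx⟩, ?_⟩
    rintro u v huv (h1 | h1)
    · exact hmin u v huv h1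
    · by_contra hne
      have hi0 : i ≠ 0 := by
        intro h0
        apply hx
        rw [(R.level_zero x).1 (by omega), (R.level_zero x').1 (by omega)]
      by_cases h2 : 2 ≤ i
      · obtain ⟨n, hn, g, -⟩ := R.exists_fork (i := i) (j := l u) (by omega) (by omega) hx hlx hlx'
          hne rfl huv.symm (Or.inl h2)
        exact hD n (by omega) ⟨g⟩
      · have hi1 : i = 1 := by omega
        by_cases h3 : ∃ y y', y ≠ y' ∧ l y = 2 ∧ l y' = 2
        · obtain ⟨y, y', hy, hly, hly'⟩ := h3
          obtain ⟨n, hn, g, -⟩ := R.exists_fork (i := 2) (j := l u) (by omega) (by omega) hy hly hly'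
            hne rfl huv.symm (Or.inl le_rfl)
          exact hD n (by omega) ⟨g⟩
        · push Not at h3
          obtain ⟨n, hn, g, -⟩ := R.exists_fork (i := i) (j := l u) (by omega) (by omega) hx hlx hlx'
            hne rfl huv.symm (Or.inr (by
              intro y w hy hw
              obtain ⟨y', hne', hy'⟩ : ∃ y', y ≠ y' ∧ l y' = 1 := by
                by_cases h4 : y = x
                · exact ⟨x', h4 ▸ hx, by omega⟩
                · exact ⟨x, h4, by omega⟩
              obtain ⟨z, hz, hyz⟩ := hgood y y' hy hy' hne'
              by_cases h5 : z = w
              · exact h5 ▸ hyz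
              · exact absurd hw (h3 z w h5 hz)))
          exact hD n (by omega) ⟨g⟩
  · push Not at hex
    refine ⟨r, l, h, 0, R, ⟨r, (R.level_zero r).2 rfl⟩, ?_⟩
    intro u v huv _
    by_contra hne
    exact hex _ u v hne rfl huv.symm

/-- A hereditary class is well-quasi-ordered if its connected members are: apply Higman's lemma to
the lists of connected components. -/
theorem partiallyWellOrderedOn_of_connected {C : Set FinGraph}
    (hC : ∀ H ∈ C, ∀ K, Embeds K H → K ∈ C)
    (h : {K ∈ C | K.2.Connected}.PartiallyWellOrderedOn Embeds) :
    C.PartiallyWellOrderedOn Embeds := by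
  classical
  rw [Set.partiallyWellOrderedOn_iff_exists_lt]
  intro F hF
  have hfin : ∀ n, ∃ m, Nonempty (Fin m ≃ (F n).2.ConnectedComponent) := fun n => by
    obtain ⟨m, ⟨e⟩⟩ := Finite.exists_equiv_fin (F n).2.ConnectedComponent
    exact ⟨m, ⟨e.symm⟩⟩
  choose m σ using hfin
  have σ' := fun n => (σ n).some
  have hK : ∀ n (c : (F n).2.ConnectedComponent), ∃ K : FinGraph,
      Nonempty (K.2 ≃g (F n).2.induce c.supp) := fun n c => exists_finGraph_iso _
  choose K hK using hK
  have hmem : ∀ n c, K n c ∈ {K ∈ C | K.2.Connected} := by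
    intro n c
    obtain ⟨e⟩ := hK n c
    refine ⟨hC (F n) (hF n) _ ⟨(Embedding.induce _).comp e.toEmbedding⟩, ?_⟩
    exact e.connected_iff.2 c.connected_toSimpleGraph
  have hH := Set.PartiallyWellOrderedOn.partiallyWellOrderedOn_sublistForall₂ _ h
  obtain ⟨a, b, hab, hL⟩ := hH.exists_lt (f := fun n => List.ofFn fun i => K n (σ' n i)) (by
    intro n x hx
    obtain ⟨i, rfl⟩ := (List.mem_ofFn' _ _).1 hx
    exact hmem _ _)
  obtain ⟨g, hg, hgK⟩ := exists_strictMono_of_sublistForall₂_ofFn hL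
  refine ⟨a, b, hab, ?_⟩
  refine isIndContained_of_components (fun c => σ' b (g ((σ' a).symm c))) ?_ ?_
  · exact (σ' b).injective.comp (hg.injective.comp (σ' a).symm.injective)
  · intro c
    obtain ⟨e⟩ := hK a c
    obtain ⟨e'⟩ := hK b (σ' b (g ((σ' a).symm c)))
    have h1 := hgK ((σ' a).symm c)
    rw [Equiv.apply_symm_apply] at h1
    obtain ⟨f⟩ := h1
    exact ⟨(e'.toEmbedding.comp f).comp e.symm.toEmbedding⟩

/-- A hereditary class of bipartite permutation graphs with double-ended forks of bounded length only
is well-quasi-ordered. -/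
theorem isWQO_of_forkFree {C : Set FinGraph} (hC : ∀ H ∈ C, ∀ K, Embeds K H → K ∈ C)
    (hb : ∀ H ∈ C, H.2.IsBipartite) (hp : ∀ H ∈ C, H.2.IsPermutationGraph) {D : ℕ}
    (hD : ∀ n, D < n → ∀ H ∈ C, ¬ (doubleEndedFork n).IsIndContained H.2) : IsWQO C := by
  have h1 : C.PartiallyWellOrderedOn Embeds := by
    apply partiallyWellOrderedOn_of_connected hC
    apply (partiallyWellOrderedOn_hasWindow (D + 6)).mono
    rintro K ⟨hK, hc⟩
    exact hasWindow_of_forkFree hc (hb K hK) (hp K hK) fun n hn => hD n hn K hK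
  intro A hA hanti
  exact hanti.finite_of_partiallyWellOrderedOn (h1.mono hA)

end FinGraph

namespace SimpleGraph

/-! ### Sums of double-ended forks -/

theorem doubleEndedFork_reachable_zero {n : ℕ} (v : Fin (n + 1) ⊕ (Bool × Bool)) :
    (doubleEndedFork n).Reachable (.inl 0) v := by
  have hpath : ∀ k (hk : k < n + 1), (doubleEndedFork n).Reachable (.inl 0) (.inl ⟨k, hk⟩) := by
    intro k
    induction k with
    | zero => exact fun _ => Reachable.refl _
    | succ k ih =>
      intro hk
      refine (ih (by omega)).trans (Adj.reachable ?_)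
      rw [doubleEndedFork_adj_inl_inl]
      exact Or.inl rfl
  rcases v with i | ⟨_ | _, b⟩
  · exact hpath i.1 i.2
  · refine Adj.reachable ?_
    rw [doubleEndedFork_adj_inl_false]
    rfl
  · refine (hpath n (by omega)).trans (Adj.reachable ?_)
    rw [doubleEndedFork_adj_inl_true]

theorem doubleEndedFork_eq_end {n : ℕ} {v a b c : Fin (n + 1) ⊕ (Bool × Bool)}
    (ha : (doubleEndedFork n).Adj v a) (hb : (doubleEndedFork n).Adj v b)
    (hc : (doubleEndedFork n).Adj v c) (hab : a ≠ b) (hac : a ≠ c) (hbc : b ≠ c) :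
    v = .inl 0 ∨ v = .inl (Fin.last n) := by
  rcases v with k | ⟨s, t⟩
  · by_contra hk
    push Not at hk
    have h0 : k.val ≠ 0 := fun h => hk.1 (congrArg Sum.inl (Fin.ext h))
    have h1 : k.val ≠ n := fun h => hk.2 (congrArg Sum.inl (Fin.ext h))
    have key : ∀ w, (doubleEndedFork n).Adj (.inl k) w →
        ∃ m : Fin (n + 1), w = .inl m ∧ (k.val + 1 = m.val ∨ m.val + 1 = k.val) := by
      rintro (m | ⟨_ | _, t⟩) hw
      · exact ⟨m, rfl, (doubleEndedFork_adj_inl_inl _ _).1 hw⟩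
      · exact absurd ((doubleEndedFork_adj_inl_false _ _).1 hw) h0
      · exact absurd ((doubleEndedFork_adj_inl_true _ _).1 hw) h1
    obtain ⟨a, rfl, ha⟩ := key a ha
    obtain ⟨b, rfl, hb⟩ := key b hb
    obtain ⟨c, rfl, hc⟩ := key c hc
    have hab' : a.val ≠ b.val := fun h => hab (by rw [Fin.ext h])
    have hac' : a.val ≠ c.val := fun h => hac (by rw [Fin.ext h])
    have hbc' : b.val ≠ c.val := fun h => hbc (by rw [Fin.ext h])
    omega
  · exfalso
    have key : ∀ w, (doubleEndedFork n).Adj (.inr (s, t)) w →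
        w = .inl (if s then Fin.last n else 0) := by
      rintro (m | w) hw
      · rw [adj_comm] at hw
        cases s
        · rw [doubleEndedFork_adj_inl_false] at hw
          exact congrArg Sum.inl (Fin.ext hw)
        · rw [doubleEndedFork_adj_inl_true] at hw
          exact congrArg Sum.inl (Fin.ext hw)
      · exact absurd hw (not_doubleEndedFork_adj_inr_inr _ _)
    exact hab ((key a ha).trans (key b hb).symm)

/-- Both ends of the path of a double-ended fork have three neighbours. -/
theorem exists_three_neighbors_of_fork {V : Type*} {G : SimpleGraph V} {n : ℕ} (hn : 1 ≤ n)
    (f : doubleEndedFork n ↪g G) {e : Fin (n + 1)} (he : e = 0 ∨ e = Fin.last n) :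
    ∃ a b c, G.Adj (f (.inl e)) a ∧ G.Adj (f (.inl e)) b ∧ G.Adj (f (.inl e)) c ∧
      a ≠ b ∧ a ≠ c ∧ b ≠ c := by
  have hinj := f.injective
  rcases he with rfl | rfl
  · refine ⟨f (.inl ⟨1, by omega⟩), f (.inr (false, false)), f (.inr (false, true)),
      f.map_adj_iff.2 ?_, f.map_adj_iff.2 ?_, f.map_adj_iff.2 ?_, ?_, ?_, ?_⟩
    · rw [doubleEndedFork_adj_inl_inl]; left; rfl
    · rw [doubleEndedFork_adj_inl_false]; rfl
    · rw [doubleEndedFork_adj_inl_false]; rfl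
    all_goals
      intro h
      have := hinj h
      simp at this
  · refine ⟨f (.inl ⟨n - 1, by omega⟩), f (.inr (true, false)), f (.inr (true, true)),
      f.map_adj_iff.2 ?_, f.map_adj_iff.2 ?_, f.map_adj_iff.2 ?_, ?_, ?_, ?_⟩
    · rw [doubleEndedFork_adj_inl_inl]; right; simp; omega
    · rw [doubleEndedFork_adj_inl_true]; rfl
    · rw [doubleEndedFork_adj_inl_true]; rfl
    all_goals
      intro h
      have := hinj h
      simp at this

/-- Double-ended forks of different lengths are incomparable: an embedding maps the two vertices
of degree three to the two vertices of degree three, and does not increase their distance. -/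
theorem eq_of_doubleEndedFork_isIndContained {i j : ℕ} (hi : 1 ≤ i)
    (h : (doubleEndedFork i).IsIndContained (doubleEndedFork j)) : i = j := by
  obtain ⟨f⟩ := h
  apply le_antisymm
  · have := Fintype.card_le_of_injective f f.injective
    simp at this
    omega
  · let φ : Fin (j + 1) ⊕ (Bool × Bool) → ℕ :=
      Sum.elim (fun k => k.val) (fun q => if q.1 then j else 0)
    have hφ1 : ∀ u v, (doubleEndedFork j).Adj u v → φ u ≤ φ v + 1 := by
      have h1 : ∀ (k : Fin (j + 1)) q, (doubleEndedFork j).Adj (.inl k) (.inr q) →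
          k.val = φ (.inr q) := by
        rintro k ⟨_ | _, t⟩ hq
        · exact (doubleEndedFork_adj_inl_false _ _).1 hq
        · exact (doubleEndedFork_adj_inl_true _ _).1 hq
      rintro (k | q) (m | q') huv
      · have := (doubleEndedFork_adj_inl_inl _ _).1 huv
        change k.val ≤ m.val + 1
        omega
      · have := h1 k q' huv
        change k.val ≤ _
        omega
      · have := h1 m q huv.symm
        change φ (.inr q) ≤ m.val + 1
        omega
      · exact absurd huv (not_doubleEndedFork_adj_inr_inr _ _)
    have hwalk : ∀ k (hk : k < i + 1), φ (f (.inl ⟨k, hk⟩)) ≤ φ (f (.inl 0)) + k ∧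
        φ (f (.inl 0)) ≤ φ (f (.inl ⟨k, hk⟩)) + k := by
      intro k
      induction k with
      | zero => exact fun _ => ⟨le_rfl, le_rfl⟩
      | succ k ih =>
        intro hk
        have h2 := ih (by omega)
        have h3 : (doubleEndedFork j).Adj (f (.inl ⟨k, by omega⟩)) (f (.inl ⟨k + 1, hk⟩)) := by
          rw [f.map_adj_iff, doubleEndedFork_adj_inl_inl]
          exact Or.inl rfl
        have h4 := hφ1 _ _ h3
        have h5 := hφ1 _ _ h3.symm
        omega
    obtain ⟨a, b, c, ha, hb, hc, hab, hac, hbc⟩ :=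
      exists_three_neighbors_of_fork hi f (e := 0) (Or.inl rfl)
    have h0 := doubleEndedFork_eq_end ha hb hc hab hac hbc
    obtain ⟨a, b, c, ha, hb, hc, hab, hac, hbc⟩ :=
      exists_three_neighbors_of_fork hi f (e := Fin.last i) (Or.inr rfl)
    have h1 := doubleEndedFork_eq_end ha hb hc hab hac hbc
    have hne : f (.inl 0) ≠ f (.inl (Fin.last i)) := by
      intro h
      have := f.injective h
      simp [Fin.ext_iff] at this
      omega
    have h2 := hwalk i (by omega)
    change φ (f (.inl (Fin.last i))) ≤ _ ∧ _ ≤ φ (f (.inl (Fin.last i))) + i at h2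
    rcases h0 with h0 | h0 <;> rcases h1 with h1 | h1
    · exact absurd (h0.trans h1.symm) hne
    · rw [h0, h1] at h2
      have := h2.1
      simp [φ] at this
      exact this
    · rw [h0, h1] at h2
      have := h2.2
      simp [φ] at this
      exact this
    · exact absurd (h0.trans h1.symm) hne

section DirectSum

variable {ι : Type} {V : ι → Type} {G : ∀ i, SimpleGraph (V i)}

theorem directSum_adj_mk {i : ι} {a b : V i} :
    (directSum G).Adj ⟨i, a⟩ ⟨i, b⟩ ↔ (G i).Adj a b := by
  constructor
  · rintro ⟨j, c, d, h, h1, h2⟩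
    cases h1
    cases h2
    exact h
  · exact fun h => ⟨i, a, b, h, rfl, rfl⟩

theorem fst_eq_of_directSum_adj {x y : Σ i, V i} (h : (directSum G).Adj x y) : x.1 = y.1 := by
  obtain ⟨i, a, b, -, rfl, rfl⟩ := h
  rfl

/-- An embedding of the direct sum is given by embeddings of the summands with disjoint and
mutually non-adjacent images. -/
theorem directSum_isIndContained {W : Type*} {H : SimpleGraph W} (f : ∀ i, G i ↪g H)
    (hne : ∀ i j a b, i ≠ j → f i a ≠ f j b) (hadj : ∀ i j a b, i ≠ j → ¬ H.Adj (f i a) (f j b)) :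
    (directSum G).IsIndContained H := by
  refine ⟨⟨⟨fun x => f x.1 x.2, ?_⟩, ?_⟩⟩
  · rintro ⟨i, a⟩ ⟨j, b⟩ h
    by_cases hij : i = j
    · subst hij
      exact congrArg (Sigma.mk i) ((f i).injective h)
    · exact absurd h (hne i j a b hij)
  · rintro ⟨i, a⟩ ⟨j, b⟩
    change H.Adj (f i a) (f j b) ↔ _
    by_cases hij : i = j
    · subst hij
      rw [directSum_adj_mk, (f i).map_adj_iff]
    · exact iff_of_false (hadj i j a b hij) fun h => hij (fst_eq_of_directSum_adj h)

theorem isIndContained_directSum (i : ι) : (G i).IsIndContained (directSum G) :=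
  ⟨⟨⟨fun a => ⟨i, a⟩, fun a b h => by cases h; rfl⟩, directSum_adj_mk⟩⟩

/-- A connected graph that embeds in a direct sum embeds in one of the summands. -/
theorem exists_isIndContained_of_directSum {W : Type*} {H : SimpleGraph W} {w₀ : W}
    (hw : ∀ w, H.Reachable w₀ w) (h : H.IsIndContained (directSum G)) :
    ∃ i, H.IsIndContained (G i) := by
  obtain ⟨f⟩ := h
  have hconst : ∀ w, (f w).1 = (f w₀).1 := by
    intro w
    obtain ⟨p⟩ := hw w
    induction p with
    | nil => rfl
    | cons hadj p ih =>
      rw [← fst_eq_of_directSum_adj (f.map_adj_iff.2 hadj)] at ih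
      exact ih fun w => (hadj.symm.reachable).trans (hw w)
  refine ⟨(f w₀).1, ?_⟩
  have hex : ∀ w, ∃ a, f w = ⟨(f w₀).1, a⟩ := by
    intro w
    have := hconst w
    revert this
    generalize f w = x
    generalize (f w₀).1 = i
    rintro rfl
    exact ⟨x.2, rfl⟩
  choose g hg using hex
  refine ⟨⟨⟨g, fun a b hab => f.injective ((hg a).trans (hab ▸ (hg b).symm))⟩, ?_⟩⟩
  intro a b
  change (G _).Adj (g a) (g b) ↔ _
  rw [← directSum_adj_mk (G := G), ← hg, ← hg, f.map_adj_iff]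

end DirectSum

/-- The direct sum of the double-ended forks whose lengths belong to `I`. -/
abbrev forkSum (I : Set ℕ) : SimpleGraph (Σ i : I, Fin ((i : ℕ) + 1) ⊕ (Bool × Bool)) :=
  directSum fun i : I => doubleEndedFork (i : ℕ)

theorem forkSum_mono {I J : Set ℕ} (h : J ⊆ I) : (forkSum J).IsIndContained (forkSum I) := by
  refine directSum_isIndContained
    (fun j => ⟨⟨fun a => ⟨⟨j.1, h j.2⟩, a⟩, fun a b h => by cases h; rfl⟩, ?_⟩) ?_ ?_
  · exact directSum_adj_mk
  · intro i j a b hij he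
    apply hij
    have := congrArg (fun x => x.1.1) he
    exact Subtype.ext this
  · intro i j a b hij he
    apply hij
    have := congrArg Subtype.val (fst_eq_of_directSum_adj he)
    exact Subtype.ext this

theorem doubleEndedFork_isIndContained_forkSum {I : Set ℕ} {j : ℕ} (hj : 1 ≤ j) :
    (doubleEndedFork j).IsIndContained (forkSum I) ↔ j ∈ I := by
  constructor
  · intro h
    obtain ⟨i, hi⟩ := exists_isIndContained_of_directSum doubleEndedFork_reachable_zero h
    rw [eq_of_doubleEndedFork_isIndContained hj hi]
    exact i.2
  · intro h
    exact isIndContained_directSum (G := fun i : I => doubleEndedFork (i : ℕ)) ⟨j, h⟩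

theorem graphAge_mono {V W : Type*} {G : SimpleGraph V} {H : SimpleGraph W}
    (h : G.IsIndContained H) : G.graphAge ⊆ H.graphAge :=
  fun _ hK => IsIndContained.trans hK h

end SimpleGraph

namespace FinGraph

open SimpleGraph

/-- A representative of the double-ended fork among the finite graphs on the sets `Fin n`. -/
noncomputable def fork (n : ℕ) : FinGraph := (exists_finGraph_iso (doubleEndedFork n)).choose

theorem fork_iso (n : ℕ) : Nonempty ((fork n).2 ≃g doubleEndedFork n) :=
  (exists_finGraph_iso (doubleEndedFork n)).choose_spec

theorem fork_mem_graphAge {V : Type*} {G : SimpleGraph V} {n : ℕ} :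
    fork n ∈ G.graphAge ↔ (doubleEndedFork n).IsIndContained G := by
  obtain ⟨e⟩ := fork_iso n
  exact ⟨fun h => IsIndContained.trans ⟨e.symm.toEmbedding⟩ h,
    fun h => IsIndContained.trans ⟨e.toEmbedding⟩ h⟩

theorem eq_of_embeds_fork {i j : ℕ} (hi : 1 ≤ i) (h : Embeds (fork i) (fork j)) : i = j := by
  obtain ⟨e⟩ := fork_iso i
  obtain ⟨e'⟩ := fork_iso j
  obtain ⟨f⟩ := h
  exact eq_of_doubleEndedFork_isIndContained hi
    ⟨(e'.toEmbedding.comp f).comp e.symm.toEmbedding⟩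

theorem not_isWQO_of_forkSum {I : Set ℕ} (hI : I.Infinite) (hpos : ∀ i ∈ I, 1 ≤ i)
    {C : Set FinGraph} (hC : (forkSum I).graphAge ⊆ C) : ¬ IsWQO C := by
  intro h
  have hinj : Set.InjOn fork I := by
    intro i hi j _ hij
    exact eq_of_embeds_fork (hpos i hi) (by rw [hij]; exact IsIndContained.refl _)
  refine hI ((h (fork '' I) ?_ ?_).of_finite_image hinj)
  · rintro _ ⟨i, hi, rfl⟩
    exact hC (fork_mem_graphAge.2 ((doubleEndedFork_isIndContained_forkSum (hpos i hi)).2 hi))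
  · rintro _ ⟨i, hi, rfl⟩ _ ⟨j, hj, rfl⟩ hne hij
    exact hne (by rw [eq_of_embeds_fork (hpos i hi) hij])

theorem isAge_graphAge {V : Type} (G : SimpleGraph V) : IsAge.{u} G.graphAge := by
  refine ⟨ULift.{u} V, G.comap ULift.down, ?_⟩
  let e : G.comap ULift.down ≃g G := SimpleGraph.Iso.comap Equiv.ulift G
  exact Set.Subset.antisymm (graphAge_mono ⟨e.symm.toEmbedding⟩) (graphAge_mono ⟨e.toEmbedding⟩)

/-- Distinct infinite subsets of `I` yield distinct ages of sums of double-ended forks. -/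
theorem mk_subages {I : Set ℕ} (hI : I.Infinite) (hpos : ∀ i ∈ I, 1 ≤ i)
    {C : Set FinGraph} (hC : (forkSum I).graphAge ⊆ C) :
    Cardinal.mk {D : Set FinGraph // IsAge.{u} D ∧ D ⊆ C ∧ ¬ IsWQO D} = Cardinal.continuum := by
  apply le_antisymm
  · refine (Cardinal.mk_subtype_le _).trans ?_
    rw [Cardinal.mk_set, ← Cardinal.two_power_aleph0]
    exact Cardinal.power_le_power_left two_ne_zero (Cardinal.mk_le_aleph0_iff.2 inferInstance)
  · let e : ℕ ↪ I := hI.natEmbedding I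
    -- the even positions make the subset infinite, the odd ones encode `X`
    let J : Set ℕ → Set ℕ := fun X => {i | ∃ n, (e n).1 = i ∧ (Even n ∨ ∃ m ∈ X, n = 2 * m + 1)}
    have hJI : ∀ X, J X ⊆ I := by
      rintro X i ⟨n, rfl, -⟩
      exact (e n).2
    have hJinf : ∀ X, (J X).Infinite := by
      intro X
      refine Set.infinite_of_injective_forall_mem (f := fun n => (e (2 * n)).1) ?_ ?_
      · intro a b hab
        have := e.injective (Subtype.ext hab)
        omega
      · exact fun n => ⟨2 * n, rfl, Or.inl ⟨n, by ring⟩⟩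
    have hJmem : ∀ X m, (e (2 * m + 1)).1 ∈ J X ↔ m ∈ X := by
      intro X m
      constructor
      · rintro ⟨n, hn, h⟩
        have hn' : n = 2 * m + 1 := e.injective (Subtype.ext hn)
        subst hn'
        rcases h with h | ⟨m', hm', h⟩
        · exact absurd h (by simp)
        · have : m = m' := by omega
          exact this ▸ hm'
      · exact fun hm => ⟨_, rfl, Or.inr ⟨m, hm, rfl⟩⟩
    have hcard : Cardinal.mk (Set ℕ) = Cardinal.continuum := by simp
    rw [← hcard]
    refine Cardinal.mk_le_of_injective (f := fun X => ⟨(forkSum (J X)).graphAge,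
      isAge_graphAge _, (graphAge_mono (forkSum_mono (hJI X))).trans hC,
      not_isWQO_of_forkSum (hJinf X) (fun i hi => hpos i (hJI X hi)) subset_rfl⟩) ?_
    intro X Y hXY
    have hXY' : (forkSum (J X)).graphAge = (forkSum (J Y)).graphAge := congrArg Subtype.val hXY
    ext m
    have hp := hpos _ (e (2 * m + 1)).2
    rw [← hJmem, ← hJmem Y, ← doubleEndedFork_isIndContained_forkSum hp,
      ← doubleEndedFork_isIndContained_forkSum hp, ← fork_mem_graphAge, ← fork_mem_graphAge, hXY']

end FinGraph

namespace SimpleGraph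

/-! ### Induced paths in incomparability graphs -/

/-- `p 0, …, p n` is an induced path of `G`. -/
def IsInducedPath {V : Type*} (G : SimpleGraph V) (p : ℕ → V) (n : ℕ) : Prop :=
  ∀ a b, a < b → b ≤ n → p a ≠ p b ∧ (G.Adj (p a) (p b) ↔ a + 1 = b)

namespace IsIncomparabilityGraph

variable {V : Type*} {G : SimpleGraph V} {lt : V → V → Prop}

/-- An induced path has a direction: if its third vertex lies above its first one, then every
vertex lies below the one two steps later. -/
theorem lt_add_two (h : IsIncomparabilityGraph G lt) {p : ℕ → V} {n : ℕ}
    (hp : IsInducedPath G p n) (h02 : lt (p 0) (p 2)) :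
    ∀ i, i + 2 ≤ n → lt (p i) (p (i + 2)) := by
  intro i
  induction i with
  | zero => exact fun _ => h02
  | succ i ih =>
    intro hi
    have h1 := ih (by omega)
    have hadj : G.Adj (p (i + 2)) (p (i + 3)) :=
      (hp (i + 2) (i + 3) (by omega) (by omega)).2.2 rfl
    have hadj' : G.Adj (p i) (p (i + 1)) := (hp i (i + 1) (by omega) (by omega)).2.2 rfl
    obtain ⟨hne, hna⟩ := hp i (i + 3) (by omega) (by omega)
    obtain ⟨hne', hna'⟩ := hp (i + 1) (i + 3) (by omega) (by omega)
    have h2 : lt (p i) (p (i + 3)) := by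
      rcases h.comparable hne (fun h3 => by have := hna.1 h3; omega) with h3 | h3
      · exact h3
      · exact absurd hadj (h.not_adj_of_gt (h.trans _ _ _ h3 h1))
    rcases h.comparable hne' (fun h3 => by have := hna'.1 h3; omega) with h3 | h3
    · exact h3
    · exact absurd hadj' (h.not_adj_of_lt (h.trans _ _ _ h2 h3))

/-- Along an upward directed induced path, the distance from a minimal vertex grows by at least one
in every six steps. -/
theorem le_dist_of_isInducedPath_aux (h : IsIncomparabilityGraph G lt) [Finite V]
    (hG : G.Connected) (hb : G.IsBipartite) {p : ℕ → V} {k : ℕ}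
    (hp : IsInducedPath G p (6 * k)) (h02 : lt (p 0) (p 2)) : k ≤ G.dist (p 0) (p (6 * k)) := by
  have := hG.nonempty
  obtain ⟨a, ha⟩ := h.exists_minimal
  have hlt := h.lt_add_two hp h02
  have hmono : ∀ i, i + 2 ≤ 6 * k → G.dist a (p i) ≤ G.dist a (p (i + 2)) :=
    fun i hi => h.dist_mono hG ha (hlt i hi)
  -- four vertices of the path at even steps cannot all have the same level
  have hstep : ∀ i, i + 6 ≤ 6 * k → G.dist a (p i) < G.dist a (p (i + 6)) := by
    intro i hi
    have h1 := hmono i (by omega)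
    have h2 := hmono (i + 2) (by omega)
    have h3 := hmono (i + 4) (by omega)
    by_contra hcon
    have h4 := hlt i (by omega)
    have h5 := hlt (i + 2) (by omega)
    have h6 := hlt (i + 4) (by omega)
    simp only [Nat.add_assoc] at h2 h3 h5 h6
    norm_num at h2 h3 h5 h6
    have h23 : G.Adj (p (i + 2)) (p (i + 3)) := (hp (i + 2) (i + 3) (by omega) (by omega)).2.2 rfl
    have h34 : G.Adj (p (i + 3)) (p (i + 4)) := (hp (i + 3) (i + 4) (by omega) (by omega)).2.2 rfl
    rcases dist_succ_or_of_adj hG hb a h23 with h7 | h7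
    · have h8 := h.adj_of_lt_right hG ha (h.trans _ _ _ h5 h6) h23 (by omega)
      have := (hp (i + 3) (i + 6) (by omega) (by omega)).2.1 h8.symm
      omega
    · have h8 := h.adj_of_lt_left hG ha (h.trans _ _ _ h4 h5) h34 (by omega)
      have := (hp i (i + 3) (by omega) (by omega)).2.1 h8.symm
      omega
  have hk : ∀ j, j ≤ k → G.dist a (p 0) + j ≤ G.dist a (p (6 * j)) := by
    intro j
    induction j with
    | zero => simp
    | succ j ih =>
      intro hj
      have h1 := ih (by omega)
      have h2 := hstep (6 * j) (by omega)
      rw [show 6 * (j + 1) = 6 * j + 6 by ring]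
      omega
  have h1 := hk k le_rfl
  have h2 := hG.dist_triangle (u := a) (v := p 0) (w := p (6 * k))
  omega

/-- The distance between the ends of an induced path grows linearly with its length. -/
theorem le_dist_of_isInducedPath (h : IsIncomparabilityGraph G lt) [Finite V]
    (hG : G.Connected) (hb : G.IsBipartite) {p : ℕ → V} {k : ℕ}
    (hp : IsInducedPath G p (6 * k)) : k ≤ G.dist (p 0) (p (6 * k)) := by
  rcases Nat.eq_zero_or_pos k with rfl | hk
  · exact Nat.zero_le _
  obtain ⟨hne, hna⟩ := hp 0 2 (by omega) (by omega)
  rcases h.comparable hne (fun h3 => by have := hna.1 h3; omega) with h1 | h1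
  · exact h.le_dist_of_isInducedPath_aux hG hb hp h1
  · exact h.swap.le_dist_of_isInducedPath_aux hG hb hp h1

/-- A walk that enters the up-set of `v` passes through `v` or through a neighbour of `v`. -/
theorem exists_crossing (h : IsIncomparabilityGraph G lt) {v b u : V}
    (p : G.Walk b u) (hb : ¬ lt v b) (hu : lt v u) :
    ∃ (y : V) (q : G.Walk y u), (y = v ∨ G.Adj v y) ∧ q.length ≤ p.length := by
  induction p with
  | nil => exact absurd hu hb
  | @cons b c u hbc p ih =>
    by_cases hc : lt v c
    · refine ⟨b, Walk.cons hbc p, ?_, le_rfl⟩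
      by_contra hn
      push Not at hn
      rcases h.comparable hn.1 (fun h3 => hn.2 h3.symm) with h1 | h1
      · exact h.not_adj_of_lt (h.trans _ _ _ h1 hc) hbc
      · exact hb h1
    · obtain ⟨y, q, hy, hq⟩ := ih hc hu
      exact ⟨y, q, hy, by rw [Walk.length_cons]; omega⟩

/-- A geodesic from `s` to a vertex above `s` contains no vertex below `s`. -/
theorem not_lt_of_mem_geodesic (h : IsIncomparabilityGraph G lt) {s v z : V} (q : G.Walk s v)
    (hq : q.length = G.dist s v) (hv : lt s v) (hz : z ∈ q.support) : ¬ lt z s := by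
  classical
  intro hzs
  have hlen : (q.takeUntil z hz).length + (q.dropUntil z hz).length = q.length := by
    rw [← Walk.length_append, Walk.take_spec]
  obtain ⟨y, q', hy, hq'⟩ := h.exists_crossing (q.dropUntil z hz) (h.asymm hzs) hv
  have h1 : G.dist s v ≤ q'.length + 1 := by
    rcases hy with rfl | hy
    · exact (dist_le q').trans (Nat.le_succ _)
    · exact dist_le (Walk.cons hy q')
  have h2 : 2 ≤ (q.takeUntil z hz).length := by
    by_contra h3
    have h4 : G.dist s z ≤ 1 := (dist_le (q.takeUntil z hz)).trans (by omega)
    have hr : G.Reachable s z := ⟨q.takeUntil z hz⟩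
    have hne : s ≠ z := by rintro rfl; exact h.irrefl _ hzs
    have := hr.one_lt_dist_of_ne_of_not_adj hne (h.not_adj_of_gt hzs)
    omega
  omega

end IsIncomparabilityGraph

/-! ### Double-ended forks far from a given vertex -/

section Star

variable {V : Type*} {G : SimpleGraph V} {s : V}

/-- `A` contains `s`, and every vertex of `A` is reached from `s` by a walk in `A` that exceeds
the distance in `G` by at most `2`. -/
def IsNearlyGeodesic (G : SimpleGraph V) (s : V) (A : Set V) : Prop :=
  s ∈ A ∧ ∀ z ∈ A, ∃ w : G.Walk s z, (∀ y ∈ w.support, y ∈ A) ∧ w.length ≤ G.dist s z + 2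

theorem IsNearlyGeodesic.union {A B : Set V} (hA : IsNearlyGeodesic G s A)
    (hB : IsNearlyGeodesic G s B) : IsNearlyGeodesic G s (A ∪ B) := by
  refine ⟨Or.inl hA.1, ?_⟩
  rintro z (hz | hz)
  · obtain ⟨w, hw, hl⟩ := hA.2 z hz
    exact ⟨w, fun y hy => Or.inl (hw y hy), hl⟩
  · obtain ⟨w, hw, hl⟩ := hB.2 z hz
    exact ⟨w, fun y hy => Or.inr (hw y hy), hl⟩

theorem connected_induce_of_walks {A : Set V} (hs : s ∈ A)
    (hA : ∀ z ∈ A, ∃ w : G.Walk s z, ∀ y ∈ w.support, y ∈ A) : (G.induce A).Connected := by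
  rw [connected_iff_exists_forall_reachable]
  refine ⟨⟨s, hs⟩, ?_⟩
  rintro ⟨z, hz⟩
  obtain ⟨w, hw⟩ := hA z hz
  exact ⟨w.induce A hw⟩

theorem length_walk_induce {A : Set V} {u v : V} (w : G.Walk u v) (hw : ∀ y ∈ w.support, y ∈ A) :
    (w.induce A hw).length = w.length := by
  induction w with
  | nil => rfl
  | cons h p ih => rw [Walk.induce_cons, Walk.length_cons, Walk.length_cons, ih]

theorem IsNearlyGeodesic.connected {A : Set V} (hA : IsNearlyGeodesic G s A) :
    (G.induce A).Connected :=
  connected_induce_of_walks hA.1 fun z hz => by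
    obtain ⟨w, hw, -⟩ := hA.2 z hz
    exact ⟨w, hw⟩

theorem IsNearlyGeodesic.dist_induce {A : Set V} (hA : IsNearlyGeodesic G s A) (z : A) :
    G.dist s z ≤ (G.induce A).dist ⟨s, hA.1⟩ z ∧
      (G.induce A).dist ⟨s, hA.1⟩ z ≤ G.dist s z + 2 := by
  constructor
  · obtain ⟨w, hw⟩ := hA.connected.exists_walk_length_eq_dist ⟨s, hA.1⟩ z
    rw [← hw, ← Walk.length_map (Embedding.induce A).toHom w]
    exact dist_le _
  · obtain ⟨w, hw, hl⟩ := hA.2 z z.2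
    refine (dist_le (w.induce A hw)).trans ?_
    rwa [length_walk_induce]

/-- `v` has three neighbours in `A`. -/
def IsBranchIn (G : SimpleGraph V) (A : Set V) (v : V) : Prop :=
  v ∈ A ∧ ∃ a ∈ A, ∃ b ∈ A, ∃ c ∈ A, G.Adj v a ∧ G.Adj v b ∧ G.Adj v c ∧ a ≠ b ∧ a ≠ c ∧ b ≠ c

theorem IsBranchIn.mono {A B : Set V} {v : V} (h : IsBranchIn G A v) (hAB : A ⊆ B) :
    IsBranchIn G B v := by
  obtain ⟨hv, a, ha, b, hb, c, hc, h⟩ := h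
  exact ⟨hAB hv, a, hAB ha, b, hAB hb, c, hAB hc, h⟩

theorem IsBranchIn.induce {A : Set V} {v : V} (h : IsBranchIn G A v) :
    IsBranchIn (G.induce A) Set.univ ⟨v, h.1⟩ := by
  obtain ⟨hv, a, ha, b, hb, c, hc, h1, h2, h3, h4, h5, h6⟩ := h
  exact ⟨trivial, ⟨a, ha⟩, trivial, ⟨b, hb⟩, trivial, ⟨c, hc⟩, trivial, h1, h2, h3,
    fun h => h4 (congrArg Subtype.val h), fun h => h5 (congrArg Subtype.val h),
    fun h => h6 (congrArg Subtype.val h)⟩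

/-- A geodesic from `s` to a branch vertex `v`, together with three neighbours of `v`. -/
theorem exists_geodesic_set {v : V} (hv : IsBranchIn G Set.univ v) (hr : G.Reachable s v) :
    ∃ A : Set V, A.Finite ∧ IsNearlyGeodesic G s A ∧ IsBranchIn G A v ∧
      ∀ z ∈ A, (∃ q : G.Walk s v, q.length = G.dist s v ∧ z ∈ q.support) ∨ G.Adj v z := by
  classical
  obtain ⟨-, a, -, b, -, c, -, ha, hb, hc, hab, hac, hbc⟩ := hv
  obtain ⟨q, hq⟩ := hr.exists_walk_length_eq_dist
  have hmem : ∀ z, z ∈ {z | z ∈ q.support} ∪ {a, b, c} → z ∈ q.support ∨ G.Adj v z := by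
    rintro z (hz | rfl | rfl | rfl)
    · exact Or.inl hz
    · exact Or.inr ha
    · exact Or.inr hb
    · exact Or.inr hc
  refine ⟨{z | z ∈ q.support} ∪ {a, b, c}, ?_, ⟨Or.inl q.start_mem_support, ?_⟩,
    ⟨Or.inl q.end_mem_support, a, by simp, b, by simp, c, by simp, ha, hb, hc, hab, hac, hbc⟩, ?_⟩
  · exact (List.finite_toSet q.support).union (by simp)
  · intro z hz
    rcases hmem z hz with h | h
    · refine ⟨q.takeUntil z h, fun y hy => Or.inl (q.support_takeUntil_subset_support h hy), ?_⟩
      have h1 : (q.takeUntil z h).length + (q.dropUntil z h).length = q.length := by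
        rw [← Walk.length_append, Walk.take_spec]
      have h2 : G.dist s v ≤ G.dist s z + G.dist z v :=
        Reachable.dist_triangle_left ⟨q.takeUntil z h⟩ _
      have h3 := dist_le (q.dropUntil z h)
      omega
    · refine ⟨q.concat h, ?_, ?_⟩
      · intro y hy
        rw [Walk.support_concat, List.mem_append, List.mem_singleton] at hy
        rcases hy with hy | rfl
        · exact Or.inl hy
        · exact hz
      · rw [Walk.length_concat, hq]
        have h2 : G.dist s v ≤ G.dist s z + G.dist z v :=
          Reachable.dist_triangle_right h.symm.reachable _
        have h3 := dist_le h.symm.toWalk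
        simp at h3
        omega
  · intro z hz
    rcases hmem z hz with h | h
    · exact Or.inl ⟨q, hq, h⟩
    · exact Or.inr h

end Star

theorem LevelRep.exists_level_of_branch {V : Type*} {G : SimpleGraph V} {r : V} {l h : V → ℕ}
    (R : LevelRep G r l h) {v : V} (hv : IsBranchIn G Set.univ v) :
    ∃ i x x', x ≠ x' ∧ l x = i ∧ l x' = i ∧ i ≤ l v + 1 ∧ l v ≤ i + 1 := by
  obtain ⟨-, a, -, b, -, c, -, ha, hb, hc, hab, hac, hbc⟩ := hv
  have h1 := R.level_of_adj ha
  have h2 := R.level_of_adj hb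
  have h3 := R.level_of_adj hc
  by_cases h4 : l a = l b
  · exact ⟨l a, a, b, hab, rfl, h4.symm, by omega, by omega⟩
  · by_cases h5 : l a = l c
    · exact ⟨l a, a, c, hac, rfl, h5.symm, by omega, by omega⟩
    · exact ⟨l b, b, c, hbc, rfl, by omega, by omega, by omega⟩

/-- Two branch vertices above `s`, at very different distances from `s`, give a double-ended fork
far away from `s`: in the union of geodesics to these vertices, `s` is a minimal element and so
the root of a level representation. -/
theorem IsIncomparabilityGraph.exists_fork_far {V : Type*} {G : SimpleGraph V}
    {lt : V → V → Prop} (h : IsIncomparabilityGraph G lt) (hb : G.IsBipartite) {s v v' : V}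
    {d m : ℕ} (hv : IsBranchIn G Set.univ v) (hv' : IsBranchIn G Set.univ v')
    (hr : G.Reachable s v) (hr' : G.Reachable s v') (hlt : lt s v) (hlt' : lt s v')
    (hd : d + 10 ≤ G.dist s v) (hd' : G.dist s v + m + 10 ≤ G.dist s v') :
    ∃ n, m ≤ n ∧ ∃ f : doubleEndedFork n ↪g G, ∀ x, G.Reachable s (f x) ∧ d ≤ G.dist s (f x) := by
  obtain ⟨A, hAf, hA, hbA, hAq⟩ := exists_geodesic_set hv hr
  obtain ⟨A', hAf', hA', hbA', hAq'⟩ := exists_geodesic_set hv' hr'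
  have hW := hA.union hA'
  have hmin : ∀ z ∈ A ∪ A', ¬ lt z s := by
    have key : ∀ u z, lt s u → ((∃ q : G.Walk s u, q.length = G.dist s u ∧ z ∈ q.support) ∨
        G.Adj u z) → ¬ lt z s := by
      rintro u z hu (⟨q, hq, hz⟩ | hz)
      · exact h.not_lt_of_mem_geodesic q hq hu hz
      · exact fun hzs => h.not_adj_of_gt (h.trans _ _ _ hzs hu) hz
    rintro z (hz | hz)
    · exact key v z hlt (hAq z hz)
    · exact key v' z hlt' (hAq' z hz)
  have hfin : Finite ↑(A ∪ A') := (hAf.union hAf').to_subtype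
  have hK : IsIncomparabilityGraph (G.induce (A ∪ A')) (fun x y => lt x y) := by
    refine ⟨fun x => h.irrefl x, fun x y z => h.trans x y z, fun x y => ?_⟩
    rw [induce_adj, h.adj_iff, Ne, ← Subtype.ext_iff]
  have hKb : (G.induce (A ∪ A')).IsBipartite :=
    Colorable.of_hom (Embedding.induce (A ∪ A')).toHom hb
  obtain ⟨g, R⟩ := hK.exists_levelRep hW.connected hKb (a := ⟨s, hW.1⟩) (fun z => hmin z z.2)
  have hbv := (hbA.mono Set.subset_union_left : IsBranchIn G (A ∪ A') v)
  have hbv' := (hbA'.mono Set.subset_union_right : IsBranchIn G (A ∪ A') v')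
  have hdv := hW.dist_induce ⟨v, hbv.1⟩
  have hdv' := hW.dist_induce ⟨v', hbv'.1⟩
  obtain ⟨i, x, x', hx, hlx, hlx', hi1, hi2⟩ := R.exists_level_of_branch hbv.induce
  obtain ⟨j, z, z', hz, hlz, hlz', hj1, hj2⟩ := R.exists_level_of_branch hbv'.induce
  simp only at hdv hdv'
  obtain ⟨n, hn, f, hf⟩ := R.exists_fork (i := i) (j := j) (by omega) (by omega) hx hlx hlx'
    hz hlz hlz' (Or.inl (by omega))
  refine ⟨n, by omega, (Embedding.induce _).comp f, fun w => ⟨?_, ?_⟩⟩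
  · exact (hW.connected.preconnected ⟨s, hW.1⟩ (f w)).map (Embedding.induce (A ∪ A')).toHom
  · have h1 := (hW.dist_induce (f w)).2
    have h2 := hf w
    change d ≤ G.dist s (f w).1
    omega

/-- All finite induced subgraphs are bipartite and incomparability graphs of orders. -/
def IsLocallyBipartitePermutation {V : Type*} (G : SimpleGraph V) : Prop :=
  ∀ W : Set V, W.Finite → (G.induce W).IsBipartite ∧
    ∃ lt, IsIncomparabilityGraph (G.induce W) lt

namespace IsLocallyBipartitePermutation

variable {V : Type*} {G : SimpleGraph V}

/-- If there are branch vertices arbitrarily far from `s`, then there are long double-ended forks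
arbitrarily far from `s`: of three branch vertices, two lie on the same side of `s`. -/
theorem exists_fork_far (hG : IsLocallyBipartitePermutation G) {s : V}
    (hbr : ∀ D, ∃ v, IsBranchIn G Set.univ v ∧ G.Reachable s v ∧ D ≤ G.dist s v) (d m : ℕ) :
    ∃ n, m ≤ n ∧ ∃ f : doubleEndedFork n ↪g G, ∀ x, G.Reachable s (f x) ∧ d ≤ G.dist s (f x) := by
  obtain ⟨v₁, hv₁, hr₁, hd₁⟩ := hbr (d + 12)
  obtain ⟨v₂, hv₂, hr₂, hd₂⟩ := hbr (G.dist s v₁ + m + 12)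
  obtain ⟨v₃, hv₃, hr₃, hd₃⟩ := hbr (G.dist s v₂ + m + 12)
  obtain ⟨A₁, hAf₁, hA₁, hbA₁, -⟩ := exists_geodesic_set hv₁ hr₁
  obtain ⟨A₂, hAf₂, hA₂, hbA₂, -⟩ := exists_geodesic_set hv₂ hr₂
  obtain ⟨A₃, hAf₃, hA₃, hbA₃, -⟩ := exists_geodesic_set hv₃ hr₃
  obtain ⟨W, hWdef⟩ : ∃ W, W = (A₁ ∪ A₂) ∪ A₃ := ⟨_, rfl⟩
  have hWf : W.Finite := hWdef ▸ (hAf₁.union hAf₂).union hAf₃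
  have hW : IsNearlyGeodesic G s W := hWdef ▸ (hA₁.union hA₂).union hA₃
  have hb₁ : IsBranchIn G W v₁ :=
    hWdef ▸ hbA₁.mono (Set.subset_union_left.trans Set.subset_union_left)
  have hb₂ : IsBranchIn G W v₂ :=
    hWdef ▸ hbA₂.mono (Set.subset_union_right.trans Set.subset_union_left)
  have hb₃ : IsBranchIn G W v₃ := hWdef ▸ hbA₃.mono Set.subset_union_right
  obtain ⟨hbip, lt, hlt⟩ := hG W hWf
  have e₁ := hW.dist_induce ⟨v₁, hb₁.1⟩
  have e₂ := hW.dist_induce ⟨v₂, hb₂.1⟩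
  have e₃ := hW.dist_induce ⟨v₃, hb₃.1⟩
  simp only at e₁ e₂ e₃
  have hc := hW.connected.preconnected
  have hside : ∀ v : W, 2 ≤ (G.induce W).dist ⟨s, hW.1⟩ v →
      lt ⟨s, hW.1⟩ v ∨ lt v ⟨s, hW.1⟩ := by
    intro v hv
    apply hlt.comparable
    · rintro rfl
      simp at hv
    · intro hadj
      have := dist_le hadj.toWalk
      simp at this
      omega
  have main : ∃ n, m ≤ n ∧ ∃ f : doubleEndedFork n ↪g G.induce W,
      ∀ x, (G.induce W).Reachable ⟨s, hW.1⟩ (f x) ∧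
        d + 2 ≤ (G.induce W).dist ⟨s, hW.1⟩ (f x) := by
    rcases hside ⟨v₁, hb₁.1⟩ (by omega) with h₁ | h₁ <;>
    rcases hside ⟨v₂, hb₂.1⟩ (by omega) with h₂ | h₂
    · exact hlt.exists_fork_far hbip hb₁.induce hb₂.induce (hc _ _) (hc _ _) h₁ h₂
        (by omega) (by omega)
    · rcases hside ⟨v₃, hb₃.1⟩ (by omega) with h₃ | h₃
      · exact hlt.exists_fork_far hbip hb₁.induce hb₃.induce (hc _ _) (hc _ _) h₁ h₃
          (by omega) (by omega)
      · exact hlt.swap.exists_fork_far hbip hb₂.induce hb₃.induce (hc _ _) (hc _ _) h₂ h₃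
          (by omega) (by omega)
    · rcases hside ⟨v₃, hb₃.1⟩ (by omega) with h₃ | h₃
      · exact hlt.exists_fork_far hbip hb₂.induce hb₃.induce (hc _ _) (hc _ _) h₂ h₃
          (by omega) (by omega)
      · exact hlt.swap.exists_fork_far hbip hb₁.induce hb₃.induce (hc _ _) (hc _ _) h₁ h₃
          (by omega) (by omega)
    · exact hlt.swap.exists_fork_far hbip hb₁.induce hb₂.induce (hc _ _) (hc _ _) h₁ h₂
        (by omega) (by omega)
  obtain ⟨n, hn, f, hf⟩ := main
  refine ⟨n, hn, (Embedding.induce W).comp f, fun x => ⟨?_, ?_⟩⟩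
  · exact (hf x).1.map (Embedding.induce W).toHom
  · have h1 := (hW.dist_induce (f x)).2
    have h2 := (hf x).2
    change d ≤ G.dist s (f x).1
    omega

/-- The two ends of the path of a long double-ended fork are far apart. -/
theorem le_dist_ends (hG : IsLocallyBipartitePermutation G) {k n : ℕ} (hk : 6 * k ≤ n)
    (f : doubleEndedFork n ↪g G) :
    k ≤ G.dist (f (.inl 0)) (f (.inl (Fin.last n))) + (n - 6 * k) := by
  have hreach := doubleEndedFork_reachable_zero (n := n)
  let p₀ : ℕ → V := fun i => f (.inl (Fin.ofNat _ i))
  have hval : ∀ i, i ≤ n → (Fin.ofNat (n + 1) i).val = i := by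
    intro i hi
    simp [Fin.ofNat, Nat.mod_eq_of_lt (Nat.lt_succ_of_le hi)]
  have hind : IsInducedPath G p₀ n := by
    intro a b hab hb
    have ha := hval a (by omega)
    have hb := hval b hb
    constructor
    · intro h1
      have h3 := congrArg Fin.val (Sum.inl.inj (f.injective h1))
      omega
    · change G.Adj (f _) (f _) ↔ _
      rw [f.map_adj_iff, doubleEndedFork_adj_inl_inl, ha, hb]
      omega
  obtain ⟨q, hq⟩ := ((hreach (.inl (Fin.ofNat _ (6 * k)))).map f.toHom).exists_walk_length_eq_dist
  obtain ⟨W, hWdef⟩ : ∃ W, W = Set.range f ∪ {z | z ∈ q.support} := ⟨_, rfl⟩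
  have hfW : ∀ x, f x ∈ W := fun x => hWdef ▸ Or.inl ⟨x, rfl⟩
  have hqW : ∀ z ∈ q.support, z ∈ W := fun z hz => hWdef ▸ Or.inr hz
  have hWf : W.Finite := hWdef ▸ (Set.finite_range f).union (List.finite_toSet q.support)
  have hWc : (G.induce W).Connected := by
    classical
    refine connected_induce_of_walks (s := f (.inl 0)) (hfW _) ?_
    intro z hz
    have hz' : z ∈ Set.range f ∪ {z | z ∈ q.support} := hWdef ▸ hz
    rcases hz' with ⟨x, rfl⟩ | hz'
    · obtain ⟨w⟩ := hreach x
      refine ⟨w.map f.toHom, fun y hy => ?_⟩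
      rw [Walk.support_map, List.mem_map] at hy
      obtain ⟨x', -, rfl⟩ := hy
      exact hfW x'
    · exact ⟨q.takeUntil z hz', fun y hy => hqW y (q.support_takeUntil_subset_support hz' hy)⟩
  obtain ⟨hbip, lt, hlt⟩ := hG W hWf
  have := hWf.to_subtype
  have hp : IsInducedPath (G.induce W) (fun i => ⟨p₀ i, hfW _⟩) (6 * k) := by
    intro a b hab hb
    obtain ⟨h1, h2⟩ := hind a b hab (by omega)
    exact ⟨fun h => h1 (congrArg Subtype.val h), h2⟩
  have h1 := hlt.le_dist_of_isInducedPath hWc hbip hp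
  have h2 := dist_le (q.induce W hqW)
  rw [length_walk_induce, hq] at h2
  have h3 : k ≤ G.dist (p₀ 0) (p₀ (6 * k)) := h1.trans h2
  have h4 : ∀ j, 6 * k + j ≤ n → k ≤ G.dist (p₀ 0) (p₀ (6 * k + j)) + j := by
    intro j
    induction j with
    | zero => exact fun _ => h3
    | succ j ih =>
      intro hj
      have h5 := ih (by omega)
      have hadj : G.Adj (p₀ (6 * k + j)) (p₀ (6 * k + (j + 1))) :=
        (hind _ _ (by omega) hj).2.2 (by omega)
      have h6 := hadj.symm.reachable.dist_triangle_right (p₀ 0)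
      have h7 := dist_le hadj.symm.toWalk
      simp only [Walk.length_cons, Walk.length_nil] at h7
      omega
  have h5 := h4 (n - 6 * k) (by omega)
  have h6 : p₀ (6 * k + (n - 6 * k)) = f (.inl (Fin.last n)) := by
    have h7 : 6 * k + (n - 6 * k) = n := by omega
    rw [h7]
    exact congrArg (fun i => f (.inl i)) (Fin.ext (hval n le_rfl))
  rw [h6] at h5
  exact h5

/-- A finite set of vertices does not prevent long double-ended forks: if arbitrarily long ones
embed in `G`, then some of them avoid the set and its neighbourhood. -/
theorem exists_fork_avoiding (hG : IsLocallyBipartitePermutation G)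
    (hf : ∀ D, ∃ n, D < n ∧ (doubleEndedFork n).IsIndContained G) (S : Finset V) (m : ℕ) :
    ∃ n, m ≤ n ∧ ∃ f : doubleEndedFork n ↪g G, ∀ x, ∀ s ∈ S, f x ≠ s ∧ ¬ G.Adj (f x) s := by
  have hreach : ∀ {n} (f : doubleEndedFork n ↪g G) x, G.Reachable (f (.inl 0)) (f x) :=
    fun f x => (doubleEndedFork_reachable_zero x).map f.toHom
  by_cases hA : ∃ n, m ≤ n ∧ ∃ f : doubleEndedFork n ↪g G, ∀ s ∈ S, ¬ G.Reachable s (f (.inl 0))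
  · obtain ⟨n, hn, f, hfs⟩ := hA
    refine ⟨n, hn, f, fun x s hs => ⟨?_, ?_⟩⟩
    · rintro rfl
      exact hfs _ hs (hreach f x).symm
    · exact fun h => hfs s hs (h.symm.reachable.trans (hreach f x).symm)
  · push Not at hA
    -- some component that meets `S` contains arbitrarily long double-ended forks
    have hpig : ∃ s ∈ S, ∀ D, ∃ n, D < n ∧ ∃ f : doubleEndedFork n ↪g G,
        G.Reachable s (f (.inl 0)) := by
      by_contra hcon
      push Not at hcon
      choose! B hB using hcon
      obtain ⟨n, hn, ⟨f⟩⟩ := hf (max m (S.sup B))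
      obtain ⟨s, hs, hr⟩ := hA n (by omega) f
      have : B s ≤ S.sup B := Finset.le_sup hs
      exact hB s hs n (by omega) f hr
    obtain ⟨s, hs, hlong⟩ := hpig
    have hbr : ∀ D, ∃ v, IsBranchIn G Set.univ v ∧ G.Reachable s v ∧ D ≤ G.dist s v := by
      intro D
      obtain ⟨n, hn, f, hr⟩ := hlong (6 * (2 * D + 5))
      have hends := hG.le_dist_ends (k := n / 6) (by omega) f
      have hr' := hr.trans (hreach f (.inl (Fin.last n)))
      have htri := hr.symm.dist_triangle_left (f (.inl (Fin.last n)))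
      rw [dist_comm (u := f (.inl 0)) (v := s)] at htri
      have hb : ∀ e, e = 0 ∨ e = Fin.last n → IsBranchIn G Set.univ (f (.inl e)) := by
        intro e he
        obtain ⟨a, b, c, h⟩ := exists_three_neighbors_of_fork (by omega) f he
        exact ⟨trivial, a, trivial, b, trivial, c, trivial, h⟩
      by_cases hD : D ≤ G.dist s (f (.inl 0))
      · exact ⟨_, hb 0 (Or.inl rfl), hr, hD⟩
      · exact ⟨_, hb _ (Or.inr rfl), hr', by omega⟩
    obtain ⟨n, hn, f, hfar⟩ := hG.exists_fork_far hbr (S.sup (G.dist s) + 2) m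
    refine ⟨n, hn, f, fun x s' hs' => ?_⟩
    have h1 : G.dist s s' ≤ S.sup (G.dist s) := Finset.le_sup hs'
    have h2 := (hfar x).2
    constructor
    · rintro rfl
      omega
    · intro hadj
      have h3 := hadj.symm.reachable.dist_triangle_right s
      have h4 := dist_le hadj.symm.toWalk
      simp only [Walk.length_cons, Walk.length_nil] at h4
      omega

/-- Forks of increasing lengths are chosen one after the other, each avoiding the previous ones
and their neighbours. -/
theorem exists_forkSum (hG : IsLocallyBipartitePermutation G)
    (hf : ∀ D, ∃ n, D < n ∧ (doubleEndedFork n).IsIndContained G) :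
    ∃ I : Set ℕ, I.Infinite ∧ (∀ i ∈ I, 1 ≤ i) ∧ (forkSum I).IsIndContained G := by
  classical
  obtain ⟨F, hF1, hF⟩ := exists_seq_of_forall_finset_exists
    (α := Σ n, doubleEndedFork n ↪g G) (fun F => 1 ≤ F.1)
    (fun F F' => F.1 < F'.1 ∧ ∀ x y, F'.2 x ≠ F.2 y ∧ ¬ G.Adj (F'.2 x) (F.2 y)) (by
      intro T _
      obtain ⟨n, hn, f, hfS⟩ := hG.exists_fork_avoiding hf
        (T.biUnion fun F => Finset.univ.image F.2) (T.sup (fun F => F.1) + 1)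
      refine ⟨⟨n, f⟩, by simp only; omega, fun F hFT => ⟨?_, fun x y => hfS x _ ?_⟩⟩
      · have : F.1 ≤ T.sup (fun F => F.1) := Finset.le_sup (f := fun F => F.1) hFT
        simp only
        omega
      · exact Finset.mem_biUnion.2 ⟨F, hFT, Finset.mem_image_of_mem _ (Finset.mem_univ y)⟩)
  have hmono : StrictMono fun k => (F k).1 := fun a b hab => (hF a b hab).1
  refine ⟨Set.range fun k => (F k).1, Set.infinite_range_of_injective hmono.injective, ?_, ?_⟩
  · rintro _ ⟨k, rfl⟩
    exact hF1 k
  · have hex : ∀ i : Set.range fun k => (F k).1,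
        ∃ f : doubleEndedFork (i : ℕ) ↪g G, ∃ k, F k = ⟨i, f⟩ := by
      rintro ⟨_, k, rfl⟩
      exact ⟨(F k).2, k, rfl⟩
    choose f k hk using hex
    have hsep : ∀ i j a b, i ≠ j → f i a ≠ f j b ∧ ¬ G.Adj (f i a) (f j b) := by
      intro i j a b hij
      have hkij : k i ≠ k j := by
        intro h
        have h1 := hk i
        rw [h, hk j] at h1
        exact hij (Subtype.ext (congrArg Sigma.fst h1).symm)
      rcases lt_or_gt_of_ne hkij with h | h
      · have h1 := (hF _ _ h).2
        rw [hk i, hk j] at h1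
        exact ⟨(h1 b a).1.symm, fun h2 => (h1 b a).2 h2.symm⟩
      · have h1 := (hF _ _ h).2
        rw [hk i, hk j] at h1
        exact h1 a b
    exact directSum_isIndContained f (fun i j a b hij => (hsep i j a b hij).1)
      (fun i j a b hij => (hsep i j a b hij).2)

end IsLocallyBipartitePermutation

end SimpleGraph

/-! ### Ages of bipartite permutation graphs -/

theorem SimpleGraph.isLocallyBipartitePermutation_of_graphAge {V : Type*} {G : SimpleGraph V}
    (hb : ∀ H ∈ G.graphAge, H.2.IsBipartite) (hp : ∀ H ∈ G.graphAge, H.2.IsPermutationGraph) :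
    IsLocallyBipartitePermutation G := by
  intro W hW
  have := hW.to_subtype
  obtain ⟨H, ⟨e⟩⟩ := exists_finGraph_iso (G.induce W)
  have hH : H ∈ G.graphAge := ⟨(Embedding.induce W).comp e.toEmbedding⟩
  refine ⟨Colorable.of_hom e.symm.toEmbedding.toHom (hb H hH), ?_⟩
  obtain ⟨lt, h⟩ := (hp H hH).exists_order
  refine ⟨fun u v => lt (e.symm u) (e.symm v), fun v => h.irrefl _, fun u v w => h.trans _ _ _,
    fun u v => ?_⟩
  rw [← e.symm.map_adj_iff, h.adj_iff, Ne, e.symm.injective.eq_iff]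

theorem mainTheorem11 (C : Set FinGraph) (hC : IsAge.{u} C)
    (hbip : ∀ H ∈ C, H.2.IsBipartite) (hperm : ∀ H ∈ C, H.2.IsPermutationGraph) :
    (¬ FinGraph.IsWQO C ↔
      ∃ I : Set ℕ, I.Infinite ∧ (∀ i ∈ I, 1 ≤ i) ∧
        (SimpleGraph.directSum fun i : I => SimpleGraph.doubleEndedFork (i : ℕ)).graphAge ⊆ C) ∧
    (¬ FinGraph.IsWQO C →
      Cardinal.mk {D : Set FinGraph // IsAge.{u} D ∧ D ⊆ C ∧ ¬ FinGraph.IsWQO D}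
        = Cardinal.continuum) := by
  have key : ¬ FinGraph.IsWQO C → ∃ I : Set ℕ, I.Infinite ∧ (∀ i ∈ I, 1 ≤ i) ∧
      (SimpleGraph.forkSum I).graphAge ⊆ C := by
    intro hwqo
    obtain ⟨V, G, rfl⟩ := hC
    have hG := SimpleGraph.isLocallyBipartitePermutation_of_graphAge hbip hperm
    have hlong : ∀ D, ∃ n, D < n ∧ (SimpleGraph.doubleEndedFork n).IsIndContained G := by
      by_contra hcon
      push Not at hcon
      obtain ⟨D, hD⟩ := hcon
      exact hwqo (FinGraph.isWQO_of_forkFree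
        (fun H hH K hKH => SimpleGraph.IsIndContained.trans hKH hH) hbip hperm (D := D)
        fun n hn H hH h => hD n hn (h.trans hH))
    obtain ⟨I, hI, hpos, h⟩ := hG.exists_forkSum hlong
    exact ⟨I, hI, hpos, SimpleGraph.graphAge_mono h⟩
  refine ⟨⟨key, ?_⟩, ?_⟩
  · rintro ⟨I, hI, hpos, h⟩
    exact FinGraph.not_isWQO_of_forkSum hI hpos h
  · intro hwqo
    obtain ⟨I, hI, hpos, h⟩ := key hwqo
    exact FinGraph.mk_subages hI hpos h
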